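/- **Theorem 4.2.** Let $n\ge 1$ and let $\lambda_0\in L^\infty(0,1)$ satisfy $0<m\le\lambda_0(\zeta)\le M$ for almost every $\zeta\in(0,1)$. Let $K_0,L_0\in\mathbb C^{(n-1)\times n}$ and $K_u,L_u,K_y,L_y\in\mathbb C^{1\times n}$, and consider on $L^2(0,1;\mathbb C^n)$ the single-input single-output port-Hamiltonian system $$\begin{aligned}\tfrac{\partial}{\partial t}z(\zeta,t)&=-\tfrac{\partial}{\partial\zeta}\bigl(\lambda_0(\zeta)z(\zeta,t)\bigr),\\ 0&=K_0(\lambda_0z)(0,t)+L_0(\lambda_0z)(1,t),\\ u(t)&=K_u(\lambda_0z)(0,t)+L_u(\lambda_0z)(1,t),\\ y(t)&=K_y(\lambda_0z)(0,t)+L_y(\lambda_0z)(1,t).\end{aligned}$$ Assume that it is well-posed: for every initial state in $L^2(0,1;\mathbb C^n)$ and every input $u\in L^2_{\rm loc}(0,\infty)$ there is a unique mild solution $z\in C([0,\infty);L^2(0,1;\mathbb C^n))$ with a unique output $y\in L^2_{\rm loc}(0,\infty)$, and on bounded time intervals state and output depend boundedly on the initial state and the input. (A mild solution is one that satisfies the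 equations after integration over $[0,t]$, for every $t\ge0$.) Let $A f=-(\lambda_0f)'$ be the generator of the system with $u=0$, and let $G$ be its transfer function: for $s\in\rho(A)$ and $u_0\in\mathbb C$, the solution of the form $(u_0e^{st},x\,e^{st},y_0e^{st})$ has $y_0=G(s)u_0$. Suppose that $G\not\equiv0$. Then the zero dynamics are again a well-posed port-Hamiltonian system with the same wave speed, on a possibly smaller state space. More precisely, there are $k\in\{0,\dots,n\}$, matrices $K_w,L_w\in\mathbb C^{k\times k}$ with $K_w$ invertible, and an injective matrix $J\in\mathbb C^{n\times k}$ such that: 1. The system $$\tfrac{\partial}{\partial t}w=-\tfrac{\partial}{\partial\zeta}(\lambda_0w),\qquad 0=K_w(\lambda_0w)(0,t)+L_w(\lambda_0w)(1,t),$$ with state space $L^2(0,1;\mathbb C^k)$, no input, and output $u(t)=K_uJ(\lambda_0w)(0,t)+L_uJ(\lambda_0w)(1,t)$ is well-posed. 2. The largest output nulling subspace, that is, the set of initial states $z_0$ for which some $u\in L^2_{\rm loc}(0,\infty)$ yields $y=0$, is $\{Jw_0 : w_0\in L^2(0,1;\mathbb C^k)\}$. 3. A pair $(z,u)$ consists of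 a mild solution of the original system and its input, with output $y=0$, if and only if $z(t)=Jw(t)$ for all $t\ge0$, where $w$ is a mild solution of the system in 1 whose output is $u$. -/

import Mathlib

open MeasureTheory Set
open scoped Matrix

noncomputable section

namespace PortHam

/-- `ℂⁿ` with the Euclidean norm. -/
abbrev Vec (n : ℕ) : Type := EuclideanSpace ℂ (Fin n)

/-- Lebesgue measure on the interval `(0,1)`. -/
abbrev unitMeasure : Measure ℝ := volume.restrict (Ioo (0 : ℝ) 1)

/-- The state space `L²(0,1;ℂⁿ)`. -/
abbrev State (n : ℕ) : Type := Lp (Vec n) 2 unitMeasure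

/-- `λ₀ ∈ L^∞(0,1)` with `0 < m ≤ λ₀(ζ) ≤ M` for almost every `ζ ∈ (0,1)`. -/
def IsWaveSpeed (lam : ℝ → ℝ) : Prop :=
  AEMeasurable lam unitMeasure ∧
    ∃ m M : ℝ, 0 < m ∧ ∀ᵐ ζ ∂unitMeasure, m ≤ lam ζ ∧ lam ζ ≤ M

/-- `u ∈ L²_loc([0,∞);ℂᵖ)`. -/
def LocL2 {p : ℕ} (u : ℝ → Vec p) : Prop :=
  ∀ T : ℝ, MemLp u 2 (volume.restrict (Ioc (0 : ℝ) T))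

/-- The maximal differential operator `f ↦ -(λ₀ f)'` together with the boundary traces:
`λ₀ f ∈ H¹(0,1;ℂⁿ)`, `-(λ₀ f)' = g`, `(λ₀ f)(0) = b₀` and `(λ₀ f)(1) = b₁`.
Here `h` is the absolutely continuous representative of `λ₀ f`; its derivative `-g` is in `L²`. -/
def TransportOp (lam : ℝ → ℝ) {n : ℕ} (f g : State n) (b₀ b₁ : Vec n) : Prop :=
  ∃ h : ℝ → Vec n,
    (∀ᵐ ζ ∂unitMeasure, h ζ = (lam ζ : ℂ) • f ζ) ∧
    (∀ ζ ∈ Icc (0 : ℝ) 1, h ζ = h 0 + ∫ s in (0 : ℝ)..ζ, -(g s)) ∧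
    h 0 = b₀ ∧ h 1 = b₁

/-- The boundary matrices of a port-Hamiltonian system with one wave speed,
`n` state components, `c` homogeneous boundary conditions, `p` inputs and `m` outputs:

* `∂z/∂t = -∂(λ₀ z)/∂ζ`,
* `0 = K₀ (λ₀ z)(0,t) + L₀ (λ₀ z)(1,t)`,
* `u(t) = K_u (λ₀ z)(0,t) + L_u (λ₀ z)(1,t)`,
* `y(t) = K_y (λ₀ z)(0,t) + L_y (λ₀ z)(1,t)`. -/
structure PortSystem (n c p m : ℕ) where
  K₀ : Matrix (Fin c) (Fin n) ℂ
  L₀ : Matrix (Fin c) (Fin n) ℂ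
  Ku : Matrix (Fin p) (Fin n) ℂ
  Lu : Matrix (Fin p) (Fin n) ℂ
  Ky : Matrix (Fin m) (Fin n) ℂ
  Ly : Matrix (Fin m) (Fin n) ℂ

namespace PortSystem

variable {n c p m : ℕ}

/-- The boundary values `b₀ = (λ₀ z)(0)`, `b₁ = (λ₀ z)(1)` satisfy the homogeneous boundary
conditions, and produce the input value `u` and the output value `y`. -/
def Boundary (S : PortSystem n c p m) (b₀ b₁ : Vec n) (u : Vec p) (y : Vec m) : Prop :=
  S.K₀ *ᵥ b₀.ofLp + S.L₀ *ᵥ b₁.ofLp = 0 ∧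
  S.Ku *ᵥ b₀.ofLp + S.Lu *ᵥ b₁.ofLp = u.ofLp ∧
  S.Ky *ᵥ b₀.ofLp + S.Ly *ᵥ b₁.ofLp = y.ofLp

/-- `z` is a mild solution on `[0,∞)` with input `u` and output `y`: `z` is continuous with values
in `L²(0,1;ℂⁿ)`, `u` and `y` are locally square integrable, and the equations hold after
integration in time, that is, for `t ≥ 0` the function `Z = ∫₀ᵗ z(s) ds` satisfies
`λ₀ Z ∈ H¹`, `z(t) - z(0) = -(λ₀ Z)'`, and `(λ₀ Z)(0)`, `(λ₀ Z)(1)` satisfy the boundary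
conditions with input value `∫₀ᵗ u(s) ds` and output value `∫₀ᵗ y(s) ds`.
Values at negative times are irrelevant. -/
def IsMildSolution (S : PortSystem n c p m) (lam : ℝ → ℝ)
    (z : ℝ → State n) (u : ℝ → Vec p) (y : ℝ → Vec m) : Prop :=
  ContinuousOn z (Ici 0) ∧ LocL2 u ∧ LocL2 y ∧
  ∀ t : ℝ, 0 ≤ t → ∃ b₀ b₁ : Vec n,
    TransportOp lam (∫ s in (0 : ℝ)..t, z s) (z t - z 0) b₀ b₁ ∧
    S.Boundary b₀ b₁ (∫ s in (0 : ℝ)..t, u s) (∫ s in (0 : ℝ)..t, y s)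

/-- Well-posedness on `L²(0,1;ℂⁿ)`: for every initial state and every input in `L²_loc` there is
a mild solution with output in `L²_loc`; state and output are unique; and on each bounded time
interval they depend boundedly on the initial state and the input. -/
def WellPosed (S : PortSystem n c p m) (lam : ℝ → ℝ) : Prop :=
  (∀ (z₀ : State n) (u : ℝ → Vec p), LocL2 u →
    ∃ z y, S.IsMildSolution lam z u y ∧ z 0 = z₀) ∧
  (∀ z z' u y y', S.IsMildSolution lam z u y → S.IsMildSolution lam z' u y' → z 0 = z' 0 →
    (∀ t, 0 ≤ t → z t = z' t) ∧ ∀ᵐ t ∂(volume.restrict (Ioi (0 : ℝ))), y t = y' t) ∧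
  (∀ T : ℝ, 0 < T → ∃ C : ℝ, ∀ z u y, S.IsMildSolution lam z u y →
    ∀ t ∈ Icc 0 T, ‖z t‖ ^ 2 + ∫ s in (0 : ℝ)..T, ‖y s‖ ^ 2 ≤
      C * (‖z 0‖ ^ 2 + ∫ s in (0 : ℝ)..T, ‖u s‖ ^ 2))

/-- The graph of the generator `A` of the homogeneous system: `f ∈ D(A)` and `A f = g`, where
`A f = -(λ₀ f)'` and `D(A)` consists of the `f` with `λ₀ f ∈ H¹` that satisfy the boundary
conditions with input `0`. -/
def GeneratorGraph (S : PortSystem n c p m) (lam : ℝ → ℝ) (f g : State n) : Prop :=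
  ∃ b₀ b₁ : Vec n, TransportOp lam f g b₀ b₁ ∧ ∃ y : Vec m, S.Boundary b₀ b₁ 0 y

/-- The resolvent set `ρ(A)`: the `s` for which `s - A` has a bounded everywhere defined
inverse. -/
def resolventSet (S : PortSystem n c p m) (lam : ℝ → ℝ) : Set ℂ :=
  {s | ∃ R : State n →L[ℂ] State n, ∀ f g : State n,
    S.GeneratorGraph lam f (s • f - g) ↔ f = R g}

/-- `(u₀ e^{st}, x e^{st}, y₀ e^{st})` is an exponential trajectory of the system. -/
def IsExponentialSolution (S : PortSystem n c p m) (lam : ℝ → ℝ) (s : ℂ)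
    (x : State n) (u₀ : Vec p) (y₀ : Vec m) : Prop :=
  ∃ b₀ b₁ : Vec n, TransportOp lam x (s • x) b₀ b₁ ∧ S.Boundary b₀ b₁ u₀ y₀

/-- `G` is the transfer function on `ρ(A)`: for `s ∈ ρ(A)` and every `u₀`, the exponential
trajectory with input `u₀ e^{st}` (which is unique, since `s ∈ ρ(A)`) has output
`G(s) u₀ e^{st}`. -/
def IsTransferFunction (S : PortSystem n c p m) (lam : ℝ → ℝ)
    (G : ℂ → Matrix (Fin m) (Fin p) ℂ) : Prop :=
  ∀ s ∈ S.resolventSet lam, ∀ u₀ : Vec p, ∃ x : State n,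
    S.IsExponentialSolution lam s x u₀ (WithLp.toLp 2 (G s *ᵥ u₀.ofLp))

/-- The largest output nulling subspace `V*`: the initial states for which some input in `L²_loc`
makes the output of the mild solution vanish. -/
def outputNulling (S : PortSystem n c p m) (lam : ℝ → ℝ) : Set (State n) :=
  {z₀ | ∃ z u, S.IsMildSolution lam z u 0 ∧ z 0 = z₀}

/-- The system in the variable `w`, without inputs,
`0 = K_w (λ₀ w)(0,t) + L_w (λ₀ w)(1,t)`,
whose output is the input value of `S` for the state `z = J w`. -/
def reduced (S : PortSystem n c p m) {k : ℕ} (Kw Lw : Matrix (Fin k) (Fin k) ℂ)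
    (J : Matrix (Fin n) (Fin k) ℂ) : PortSystem k k 0 p where
  K₀ := Kw
  L₀ := Lw
  Ku := 0
  Lu := 0
  Ky := S.Ku * J
  Ly := S.Lu * J

end PortSystem

/-- `z(ζ) = J w(ζ)` for almost every `ζ ∈ (0,1)`. -/
def IsImage {n k : ℕ} (J : Matrix (Fin n) (Fin k) ℂ) (w : State k) (z : State n) : Prop :=
  ∀ᵐ ζ ∂unitMeasure, (z ζ).ofLp = J *ᵥ (w ζ).ofLp

end PortHam

end

noncomputable section

namespace PortHam

open Filter Topology

/-! With p(ζ) = ∫₀^ζ λ₀⁻¹ (`travel`) as coordinate, the equation is a pure translation: (λ₀z)(ζ,t) =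
g(t - p(ζ)), where the profile g encodes the initial state on (-π,0), π = p(1), and is the trace at
ζ = 0 for t > 0. The two traces at time t are g(t) and g(t - π), so the boundary equations are
linear relations between g(t), g(t - π), u(t) and y(t).

Well-posedness and one point of the resolvent set make the square matrix stacking K₀ over K_u
invertible (`PortSystem.WellPosed.exists_discrete`). The relations become b₀ = A b₁ + B u, y = C b₁
+ D u: along almost every lattice x + πℤ the profile is a trajectory of one discrete-time system on
ℂⁿ. Zero output then means that g takes values, almost everywhere on (-π,∞), in the output nulling
subspace V of that system.

The condition G ≢ 0 enters once (`output_eq_zero_of_nulling`, `IsDiscrete.nulling_input_unique`). If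
some input u ≠ 0 had Bu ∈ V and Du = 0, then, the input being scalar, B would map into V and D would
vanish; V would be A-invariant with C = 0 on it, and solving (e^{sπ} - A)x = Bv inside V would give
G(s) = 0. Hence the nulling input is unique and is a linear feedback F on V. With J a
parametrisation of V and A_w the matrix of A + BF on V, the reduced system is K_w = 1, L_w = -A_w;
it is well-posed since its delay recursion can be solved explicitly
(`PortSystem.wellPosed_autonomous`).

Mild solutions are tied to waves by a uniqueness argument: a time-integrated potential is constant
along characteristics (`potential_characteristic`, `transport_zero_initial`), so with zero initial
state the trace at 1 is the delayed trace at 0. -/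

/-! ### Regularised wave speeds and the travel time -/

/-- A wave speed that is measurable and bounded everywhere, not only almost everywhere. -/
structure SpeedBound (lam : ℝ → ℝ) (m M : ℝ) : Prop where
  measurable : Measurable lam
  pos : 0 < m
  lower : ∀ ζ, m ≤ lam ζ
  upper : ∀ ζ, lam ζ ≤ M

/-- All the notions involved see λ₀ only up to null sets, so a measurable representative may be
clamped to obtain bounds at every point. -/
theorem IsWaveSpeed.exists_speedBound {lam : ℝ → ℝ} (h : IsWaveSpeed lam) :
    ∃ (lam' : ℝ → ℝ) (m M : ℝ), SpeedBound lam' m M ∧ lam =ᵐ[unitMeasure] lam' := by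
  obtain ⟨hmeas, m, M, hm, hb⟩ := h
  -- The upper bound `max m M` bounds the clamped function whether or not m ≤ M.
  refine ⟨fun ζ => max m (min M (hmeas.mk lam ζ)), m, max m M,
    ⟨measurable_const.max (measurable_const.min hmeas.measurable_mk), hm,
      fun ζ => le_max_left _ _, fun ζ => max_le_max le_rfl (min_le_left _ _)⟩, ?_⟩
  filter_upwards [hb, hmeas.ae_eq_mk] with ζ h1 h2
  rw [← h2, min_eq_right h1.2, max_eq_right h1.1]

/-- The time a wave needs to travel from `0` to `x`. -/
def travel (lam : ℝ → ℝ) (x : ℝ) : ℝ := ∫ s in (0 : ℝ)..x, (lam s)⁻¹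

namespace SpeedBound

variable {lam : ℝ → ℝ} {m M : ℝ} (hl : SpeedBound lam m M)
include hl

theorem lam_pos (ζ : ℝ) : 0 < lam ζ := hl.pos.trans_le (hl.lower ζ)

theorem upper_pos : 0 < M := (hl.lam_pos 0).trans_le (hl.upper 0)

theorem inv_le (ζ : ℝ) : (lam ζ)⁻¹ ≤ m⁻¹ := inv_anti₀ hl.pos (hl.lower ζ)

theorem le_inv (ζ : ℝ) : M⁻¹ ≤ (lam ζ)⁻¹ := inv_anti₀ (hl.lam_pos ζ) (hl.upper ζ)

theorem intervalIntegrable_inv (a b : ℝ) :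
    IntervalIntegrable (fun s => (lam s)⁻¹) volume a b := by
  refine (intervalIntegrable_const (c := m⁻¹)).mono_fun hl.measurable.inv.aestronglyMeasurable
    (Eventually.of_forall fun ζ => ?_)
  beta_reduce
  rw [Real.norm_of_nonneg (inv_nonneg.2 (hl.lam_pos ζ).le),
    Real.norm_of_nonneg (inv_nonneg.2 hl.pos.le)]
  exact hl.inv_le ζ

theorem travel_sub (x y : ℝ) : travel lam y - travel lam x = ∫ s in x..y, (lam s)⁻¹ :=
  intervalIntegral.integral_interval_sub_left (hl.intervalIntegrable_inv _ _)
    (hl.intervalIntegrable_inv _ _)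

/-- Growth at rate at least M⁻¹ yields both strict monotonicity and surjectivity of the travel time.
-/
theorem le_travel_sub {x y : ℝ} (h : x ≤ y) :
    (y - x) * M⁻¹ ≤ travel lam y - travel lam x := by
  rw [hl.travel_sub]
  simpa using intervalIntegral.integral_mono_on h (intervalIntegrable_const (c := M⁻¹))
    (hl.intervalIntegrable_inv x y) fun s _ => hl.le_inv s

omit hl in
@[simp] theorem travel_zero : travel lam 0 = 0 := by simp [travel]

theorem travel_strictMono : StrictMono (travel lam) := fun x y h => by
  have := hl.le_travel_sub h.le
  have h2 : 0 < (y - x) * M⁻¹ := mul_pos (sub_pos.2 h) (inv_pos.2 hl.upper_pos)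
  linarith

theorem continuous_travel : Continuous (travel lam) :=
  intervalIntegral.continuous_primitive hl.intervalIntegrable_inv 0

theorem travel_surjective : Function.Surjective (travel lam) := by
  have hM := inv_pos.2 hl.upper_pos
  refine hl.continuous_travel.surjective ?_ ?_
  · refine tendsto_atTop_mono' atTop ?_ (tendsto_id.atTop_mul_const hM)
    filter_upwards [eventually_ge_atTop 0] with x hx
    simpa using hl.le_travel_sub hx
  · refine tendsto_atBot_mono' atBot ?_ (tendsto_id.atBot_mul_const hM)
    filter_upwards [eventually_le_atBot 0] with x hx
    have := hl.le_travel_sub hx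
    simp only [travel_zero, id] at this ⊢
    linarith

/-- The travel time as an order isomorphism of the line. -/
def travelIso : ℝ ≃o ℝ :=
  hl.travel_strictMono.orderIsoOfSurjective _ hl.travel_surjective

@[simp] theorem travelIso_apply (x : ℝ) : hl.travelIso x = travel lam x := rfl

@[simp] theorem travel_symm (r : ℝ) : travel lam (hl.travelIso.symm r) = r :=
  hl.travelIso.apply_symm_apply r

@[simp] theorem symm_travel (x : ℝ) : hl.travelIso.symm (travel lam x) = x :=
  hl.travelIso.symm_apply_apply x

theorem continuous_symm : Continuous hl.travelIso.symm := hl.travelIso.symm.continuous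

theorem travel_one_pos : 0 < travel lam 1 := by
  simpa using hl.travel_strictMono (zero_lt_one' ℝ)

theorem travel_mem_Icc {ζ : ℝ} (h : ζ ∈ Icc (0 : ℝ) 1) : travel lam ζ ∈ Icc 0 (travel lam 1) :=
  ⟨by simpa using hl.travel_strictMono.monotone h.1, hl.travel_strictMono.monotone h.2⟩

theorem travel_mem_Ioo {ζ : ℝ} (h : ζ ∈ Ioo (0 : ℝ) 1) : travel lam ζ ∈ Ioo 0 (travel lam 1) :=
  ⟨by simpa using hl.travel_strictMono h.1, hl.travel_strictMono h.2⟩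

theorem symm_mem_Icc {r : ℝ} (h : r ∈ Icc 0 (travel lam 1)) :
    hl.travelIso.symm r ∈ Icc (0 : ℝ) 1 := by
  have h0 := hl.travelIso.symm.monotone h.1
  have h1 := hl.travelIso.symm.monotone h.2
  rw [hl.symm_travel] at h1
  rw [← travel_zero (lam := lam), hl.symm_travel] at h0
  exact ⟨h0, h1⟩

end SpeedBound

/-! ### Change of variables between position and travel time. -/

/-- The measure `λ₀⁻¹ dζ`. -/
def slowness (lam : ℝ → ℝ) : Measure ℝ :=
  volume.withDensity fun ζ => ((lam ζ)⁻¹.toNNReal : ENNReal)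

namespace SpeedBound

variable {lam : ℝ → ℝ} {m M : ℝ} (hl : SpeedBound lam m M)
include hl

theorem measurable_slow : Measurable fun ζ => (lam ζ)⁻¹.toNNReal :=
  hl.measurable.inv.real_toNNReal

theorem slowness_Ioc (a b : ℝ) :
    slowness lam (Ioc a b) = ENNReal.ofReal (travel lam b - travel lam a) := by
  rcases le_total b a with h | h
  · rw [Ioc_eq_empty (not_lt.2 h), measure_empty, ENNReal.ofReal_of_nonpos]
    linarith [hl.travel_strictMono.monotone h]
  · rw [slowness, withDensity_apply _ measurableSet_Ioc, hl.travel_sub,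
      intervalIntegral.integral_of_le h]
    exact (ofReal_integral_eq_lintegral_ofReal (hl.intervalIntegrable_inv a b).1
      (Eventually.of_forall fun ζ => inv_nonneg.2 (hl.lam_pos ζ).le)).symm

/-- Half-open intervals determine the measure, and the preimage of (p(x), p(y)] is (x, y], of mass
p(y) - p(x). -/
theorem measurePreserving_travel : MeasurePreserving (travel lam) (slowness lam) volume := by
  have hmeas : Measurable (travel lam) := hl.continuous_travel.measurable
  have key : ∀ a b : ℝ, (slowness lam).map (travel lam) (Ioc a b) = ENNReal.ofReal (b - a) := by
    intro a b
    obtain ⟨x, rfl⟩ := hl.travel_surjective a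
    obtain ⟨y, rfl⟩ := hl.travel_surjective b
    rw [Measure.map_apply hmeas measurableSet_Ioc, ← hl.slowness_Ioc]
    congr 1
    ext z
    simp [hl.travel_strictMono.lt_iff_lt, hl.travel_strictMono.le_iff_le]
  refine ⟨hmeas, Measure.ext_of_Ioc' _ _ (fun a b _ => ?_) fun a b _ => ?_⟩
  · rw [key]; exact ENNReal.ofReal_ne_top
  · rw [key, Real.volume_Ioc]

theorem measurableEmbedding_travel : MeasurableEmbedding (travel lam) :=
  hl.travelIso.toHomeomorph.measurableEmbedding

theorem volume_le_slowness : (volume : Measure ℝ) ≤ ENNReal.ofReal M • slowness lam := by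
  rw [slowness, ← withDensity_smul _ hl.measurable_slow.coe_nnreal_ennreal]
  conv_lhs => rw [← withDensity_one (μ := (volume : Measure ℝ))]
  refine withDensity_mono (Eventually.of_forall fun ζ => ?_)
  have h : (1 : ℝ) ≤ M * (lam ζ)⁻¹ := by
    rw [← div_eq_mul_inv, one_le_div (hl.lam_pos ζ)]
    exact hl.upper ζ
  calc (1 : ENNReal) = ENNReal.ofReal 1 := by simp
    _ ≤ ENNReal.ofReal (M * (lam ζ)⁻¹) := ENNReal.ofReal_le_ofReal h
    _ = _ := by
      rw [ENNReal.ofReal_mul hl.upper_pos.le]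
      rfl

theorem volume_absolutelyContinuous : (volume : Measure ℝ) ≪ slowness lam :=
  (Measure.absolutelyContinuous_of_le hl.volume_le_slowness).trans
    Measure.smul_absolutelyContinuous

theorem measurePreserving_delay (t : ℝ) :
    MeasurePreserving (fun ζ => t - travel lam ζ) (slowness lam) volume :=
  (Measure.measurePreserving_sub_left volume t).comp hl.measurePreserving_travel

/-- Transfers almost everywhere statements about a profile to statements about the wave at a fixed
time. -/
theorem ae_delay {P : ℝ → Prop} (h : ∀ᵐ r, P r) (t : ℝ) : ∀ᵐ ζ, P (t - travel lam ζ) :=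
  hl.volume_absolutelyContinuous.ae_le
    ((hl.measurePreserving_delay t).quasiMeasurePreserving.ae h)

/-- The substitution `r = travel ζ`. -/
theorem integral_comp_travel {E : Type*} [NormedAddCommGroup E] [NormedSpace ℝ E]
    (F : ℝ → E) {ζ : ℝ} (hζ : 0 ≤ ζ) :
    ∫ s in (0 : ℝ)..ζ, (lam s)⁻¹ • F (travel lam s) = ∫ r in (0 : ℝ)..travel lam ζ, F r := by
  have h0 : 0 ≤ travel lam ζ := by simpa using hl.travel_strictMono.monotone hζ
  rw [intervalIntegral.integral_of_le hζ, intervalIntegral.integral_of_le h0,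
    ← hl.measurePreserving_travel.setIntegral_preimage_emb hl.measurableEmbedding_travel F]
  have hpre : travel lam ⁻¹' Ioc 0 (travel lam ζ) = Ioc 0 ζ := by
    ext z
    have := hl.travel_strictMono.lt_iff_lt (a := 0) (b := z)
    simp only [travel_zero] at this
    simp [this, hl.travel_strictMono.le_iff_le]
  rw [hpre, slowness, setIntegral_withDensity_eq_setIntegral_smul hl.measurable_slow _
    measurableSet_Ioc]
  refine integral_congr_ae (Eventually.of_forall fun s => ?_)
  simp only [NNReal.smul_def, Real.coe_toNNReal _ (inv_nonneg.2 (hl.lam_pos s).le)]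

end SpeedBound

/-! ### The primitive of a state -/

/-- A locally integrable function whose integrals over all `(0,t)` vanish is zero almost
everywhere. -/
theorem ae_eq_zero_of_primitive_eq_zero {E : Type*} [NormedAddCommGroup E] [NormedSpace ℝ E]
    [CompleteSpace E] {f : ℝ → E} {T : ℝ} (hT : 0 ≤ T) (hf : IntervalIntegrable f volume 0 T)
    (h : ∀ t ∈ Icc 0 T, ∫ s in (0 : ℝ)..t, f s = 0) :
    ∀ᵐ t, t ∈ Ioo 0 T → f t = 0 := by
  filter_upwards [hf.ae_hasDerivAt_integral] with t ht hmem
  have h1 := ht (by rw [uIcc_of_le hT]; exact ⟨hmem.1.le, hmem.2.le⟩) 0 left_mem_uIcc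
  refine h1.unique ((hasDerivAt_const t (0 : E)).congr_of_eventuallyEq ?_)
  filter_upwards [Ioo_mem_nhds hmem.1 hmem.2] with s hs
  exact h s ⟨hs.1.le, hs.2.le⟩

/-- `ζ ↦ ∫₀^ζ f`, extended constantly outside `[0,1]`. -/
def prim {n : ℕ} (f : State n) (ζ : ℝ) : Vec n := ∫ s in Iic ζ, f s ∂unitMeasure

section prim

variable {n : ℕ}

instance : IsProbabilityMeasure unitMeasure := ⟨by simp⟩

theorem State.integrable (f : State n) : Integrable f unitMeasure :=
  (Lp.memLp f).integrable (by norm_num)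

theorem prim_eq_intervalIntegral (f : State n) {ζ : ℝ} (hζ : ζ ∈ Icc (0 : ℝ) 1) :
    prim f ζ = ∫ s in (0 : ℝ)..ζ, f s := by
  rw [prim, Measure.restrict_restrict measurableSet_Iic, intervalIntegral.integral_of_le hζ.1]
  refine setIntegral_congr_set ?_
  have h1 : (Iic ζ ∩ Ioo (0 : ℝ) 1 : Set ℝ) =ᵐ[volume] (Iic ζ ∩ Ioc (0 : ℝ) 1 : Set ℝ) :=
    (ae_eq_refl _).inter Ioo_ae_eq_Ioc
  have h2 : (Iic ζ ∩ Ioc (0 : ℝ) 1 : Set ℝ) = Ioc 0 ζ := by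
    ext x
    exact ⟨fun h => ⟨h.2.1, h.1⟩, fun h => ⟨h.2, h.1, h.2.trans hζ.2⟩⟩
  rwa [h2] at h1

theorem State.intervalIntegrable (f : State n) {ζ : ℝ} (hζ : ζ ∈ Icc (0 : ℝ) 1) :
    IntervalIntegrable f volume 0 ζ := by
  rw [intervalIntegrable_iff_integrableOn_Ioc_of_le hζ.1]
  refine IntegrableOn.mono_set (t := Ioc 0 1) ?_ (Ioc_subset_Ioc_right hζ.2)
  exact (integrableOn_Ioc_iff_integrableOn_Ioo).2 f.integrable

@[simp] theorem prim_zero_right (f : State n) : prim f 0 = 0 := by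
  rw [prim_eq_intervalIntegral f ⟨le_rfl, zero_le_one⟩, intervalIntegral.integral_same]

/-- The constant is 1 because on a probability space the L¹ norm is at most the L² norm. -/
theorem norm_prim_le (f : State n) (ζ : ℝ) : ‖prim f ζ‖ ≤ ‖f‖ := by
  have h1 : ‖prim f ζ‖ ≤ ∫ s, ‖f s‖ ∂unitMeasure :=
    (norm_integral_le_integral_norm _).trans
      (setIntegral_le_integral f.integrable.norm (Eventually.of_forall fun _ => norm_nonneg _))
  refine h1.trans ?_
  rw [integral_norm_eq_lintegral_enorm f.integrable.1, Lp.norm_def,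
    ← eLpNorm_one_eq_lintegral_enorm]
  exact ENNReal.toReal_mono (Lp.eLpNorm_ne_top f)
    (eLpNorm_le_eLpNorm_of_exponent_le (by norm_num) f.integrable.1)

theorem prim_add (f g : State n) (ζ : ℝ) : prim (f + g) ζ = prim f ζ + prim g ζ := by
  rw [prim, prim, prim, ← integral_add f.integrable.integrableOn g.integrable.integrableOn]
  exact integral_congr_ae (ae_restrict_of_ae (Lp.coeFn_add f g))

theorem prim_smul (c : ℂ) (f : State n) (ζ : ℝ) : prim (c • f) ζ = c • prim f ζ := by
  rw [prim, prim, ← integral_smul]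
  exact integral_congr_ae (ae_restrict_of_ae (Lp.coeFn_smul c f))

/-- `prim` as a bounded linear map of the state. -/
def primL (n : ℕ) (ζ : ℝ) : State n →L[ℂ] Vec n :=
  LinearMap.mkContinuous
    { toFun := fun f => prim f ζ
      map_add' := fun f g => prim_add f g ζ
      map_smul' := fun c f => prim_smul c f ζ } 1 fun f => by
    simpa using norm_prim_le f ζ

@[simp] theorem primL_apply (f : State n) (ζ : ℝ) : primL n ζ f = prim f ζ := rfl

@[simp] theorem prim_zero (ζ : ℝ) : prim (0 : State n) ζ = 0 := (primL n ζ).map_zero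

theorem prim_sub (f g : State n) (ζ : ℝ) : prim (f - g) ζ = prim f ζ - prim g ζ :=
  (primL n ζ).map_sub f g

theorem continuous_prim (f : State n) : Continuous (prim f) := by
  have h : prim f = fun ζ => ∫ s in (0 : ℝ)..ζ, f s ∂unitMeasure := by
    ext1 ζ
    rw [← intervalIntegral.integral_Iic_sub_Iic f.integrable.integrableOn
      f.integrable.integrableOn]
    change _ = prim f ζ - prim f 0
    rw [prim_zero_right, sub_zero]
  rw [h]
  exact intervalIntegral.continuous_primitive (fun _ _ => f.integrable.intervalIntegrable) 0

theorem prim_injective {f g : State n} (h : ∀ ζ ∈ Icc (0 : ℝ) 1, prim f ζ = prim g ζ) :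
    f = g := by
  have key : ∀ᵐ t, t ∈ Ioo (0 : ℝ) 1 → (f - g : State n) t = 0 := by
    refine ae_eq_zero_of_primitive_eq_zero zero_le_one
      ((f - g).intervalIntegrable ⟨zero_le_one, le_rfl⟩) fun t ht => ?_
    rw [← prim_eq_intervalIntegral _ ht, prim_sub, h t ht, sub_self]
  rw [← sub_eq_zero]
  refine (Lp.eq_zero_iff_ae_eq_zero).2 ?_
  exact (ae_restrict_iff' measurableSet_Ioo).2 key

theorem prim_intervalIntegral {z : ℝ → State n} {a b : ℝ} (hz : IntervalIntegrable z volume a b)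
    (ζ : ℝ) : prim (∫ s in a..b, z s) ζ = ∫ s in a..b, prim (z s) ζ :=
  ((primL n ζ).intervalIntegral_comp_comm hz).symm

/-- Joint continuity of the primitive of a continuous path of states. -/
theorem continuous_prim_path {z : ℝ → State n} (hz : Continuous z) :
    Continuous fun q : ℝ × ℝ => prim (z q.2) q.1 := by
  refine continuous_iff_continuousAt.2 fun q => ?_
  rw [ContinuousAt, tendsto_iff_norm_sub_tendsto_zero]
  have h1 : Tendsto (fun x : ℝ × ℝ => ‖z x.2 - z q.2‖ + ‖prim (z q.2) x.1 - prim (z q.2) q.1‖)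
      (𝓝 q) (𝓝 0) := by
    have : Continuous fun x : ℝ × ℝ =>
        ‖z x.2 - z q.2‖ + ‖prim (z q.2) x.1 - prim (z q.2) q.1‖ :=
      ((hz.comp continuous_snd).sub continuous_const).norm.add
        (((continuous_prim _).comp continuous_fst).sub continuous_const).norm
    simpa using this.tendsto q
  refine squeeze_zero (fun _ => norm_nonneg _) (fun x => ?_) h1
  calc ‖prim (z x.2) x.1 - prim (z q.2) q.1‖
      = ‖prim (z x.2 - z q.2) x.1 + (prim (z q.2) x.1 - prim (z q.2) q.1)‖ := by
        rw [prim_sub]; congr 1; abel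
    _ ≤ _ := (norm_add_le _ _).trans (add_le_add_left (norm_prim_le _ _) _)

end prim

/-! ### The transport operator in terms of primitives -/

section transport

variable {n : ℕ} {lam : ℝ → ℝ}

/-- The continuous representative of λ₀f is forced to be b₀ - `prim g` on [0,1], which removes the
existential over representatives. -/
theorem transportOp_iff {f g : State n} {b₀ b₁ : Vec n} :
    TransportOp lam f g b₀ b₁ ↔
      (∀ᵐ ζ ∂unitMeasure, b₀ - prim g ζ = (lam ζ : ℂ) • f ζ) ∧ b₁ = b₀ - prim g 1 := by
  constructor
  · rintro ⟨h, hf, hg, rfl, rfl⟩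
    have hh : ∀ ζ ∈ Icc (0 : ℝ) 1, h ζ = h 0 - prim g ζ := fun ζ hζ => by
      rw [hg ζ hζ, intervalIntegral.integral_neg, prim_eq_intervalIntegral g hζ, sub_eq_add_neg]
    refine ⟨?_, hh 1 ⟨zero_le_one, le_rfl⟩⟩
    filter_upwards [hf, ae_restrict_mem measurableSet_Ioo] with ζ h1 h2
    rw [← h1, hh ζ ⟨h2.1.le, h2.2.le⟩]
  · rintro ⟨hf, rfl⟩
    refine ⟨fun ζ => b₀ - prim g ζ, hf, fun ζ hζ => ?_, by simp, rfl⟩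
    beta_reduce
    rw [intervalIntegral.integral_neg, prim_eq_intervalIntegral g hζ, prim_zero_right, sub_zero,
      sub_eq_add_neg]

theorem transportOp_congr {lam' : ℝ → ℝ} (h : lam =ᵐ[unitMeasure] lam') {f g : State n}
    {b₀ b₁ : Vec n} : TransportOp lam f g b₀ b₁ ↔ TransportOp lam' f g b₀ b₁ := by
  rw [transportOp_iff, transportOp_iff]
  refine and_congr_left' ⟨fun hf => ?_, fun hf => ?_⟩ <;>
  · filter_upwards [h, hf] with ζ h1 h2
    rw [h2, h1]

theorem TransportOp.add {f g f' g' : State n} {b₀ b₁ b₀' b₁' : Vec n}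
    (h : TransportOp lam f g b₀ b₁) (h' : TransportOp lam f' g' b₀' b₁') :
    TransportOp lam (f + f') (g + g') (b₀ + b₀') (b₁ + b₁') := by
  rw [transportOp_iff] at *
  refine ⟨?_, by rw [h.2, h'.2, prim_add]; abel⟩
  filter_upwards [h.1, h'.1, Lp.coeFn_add f f'] with ζ h1 h2 h3
  rw [h3, Pi.add_apply, smul_add, ← h1, ← h2, prim_add]
  abel

theorem TransportOp.smul {f g : State n} {b₀ b₁ : Vec n} (c : ℂ)
    (h : TransportOp lam f g b₀ b₁) :
    TransportOp lam (c • f) (c • g) (c • b₀) (c • b₁) := by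
  rw [transportOp_iff] at *
  refine ⟨?_, by rw [h.2, prim_smul, smul_sub]⟩
  filter_upwards [h.1, Lp.coeFn_smul c f] with ζ h1 h3
  rw [h3, Pi.smul_apply, smul_comm, ← h1, prim_smul, smul_sub]

theorem TransportOp.sub {f g f' g' : State n} {b₀ b₁ b₀' b₁' : Vec n}
    (h : TransportOp lam f g b₀ b₁) (h' : TransportOp lam f' g' b₀' b₁') :
    TransportOp lam (f - f') (g - g') (b₀ - b₀') (b₁ - b₁') := by
  simpa [sub_eq_add_neg] using h.add (h'.smul (-1))

/-- One point where both almost everywhere identities hold determines the trace at 0; such a point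
exists since the measure is nonzero. -/
theorem TransportOp.trace_unique {f g : State n} {b₀ b₁ b₀' b₁' : Vec n}
    (h : TransportOp lam f g b₀ b₁) (h' : TransportOp lam f g b₀' b₁') :
    b₀ = b₀' ∧ b₁ = b₁' := by
  rw [transportOp_iff] at *
  obtain ⟨ζ, h1, h2⟩ := (h.1.and h'.1).exists
  have h0 : b₀ = b₀' := sub_left_injective (h1.trans h2.symm)
  exact ⟨h0, by rw [h.2, h'.2, h0]⟩

/-- The transport operator after the substitution `r = travel ζ`. -/
theorem SpeedBound.transportOp_iff_prim {m M : ℝ} (hl : SpeedBound lam m M) {f g : State n}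
    {b₀ b₁ : Vec n} :
    TransportOp lam f g b₀ b₁ ↔
      (∀ ζ ∈ Icc (0 : ℝ) 1, prim f ζ =
        ∫ r in (0 : ℝ)..travel lam ζ, (b₀ - prim g (hl.travelIso.symm r))) ∧
      b₁ = b₀ - prim g 1 := by
  have hcont : Continuous fun r => b₀ - prim g r := continuous_const.sub (continuous_prim g)
  have hsub : ∀ ζ ∈ Icc (0 : ℝ) 1, ∫ r in (0 : ℝ)..travel lam ζ,
      (b₀ - prim g (hl.travelIso.symm r)) = ∫ s in (0 : ℝ)..ζ, (lam s)⁻¹ • (b₀ - prim g s) :=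
    fun ζ hζ => by simp [← hl.integral_comp_travel _ hζ.1]
  rw [transportOp_iff]
  refine and_congr_left' ⟨fun hf ζ hζ => ?_, fun hf => ?_⟩
  · rw [hsub ζ hζ, prim_eq_intervalIntegral f hζ]
    refine intervalIntegral.integral_congr_ae ?_
    have hf' := (ae_restrict_iff' measurableSet_Ioo).1 hf
    filter_upwards [hf', Ioo_ae_eq_Ioc (a := (0 : ℝ)) (b := 1) (μ := volume)] with s h1 h2 h3
    rw [uIoc_of_le hζ.1] at h3
    have h4 : s ∈ Ioo (0 : ℝ) 1 := (iff_of_eq h2).2 ⟨h3.1, h3.2.trans hζ.2⟩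
    rw [h1 h4, ← Complex.coe_smul, smul_smul]
    norm_cast
    rw [inv_mul_cancel₀ (hl.lam_pos s).ne']
    simp
  · have hint : IntervalIntegrable (fun s => (lam s)⁻¹ • (b₀ - prim g s)) volume 0 1 :=
      (hl.intervalIntegrable_inv 0 1).smul_continuousOn hcont.continuousOn
    have key := ae_eq_zero_of_primitive_eq_zero zero_le_one
      ((f.intervalIntegrable ⟨zero_le_one, le_rfl⟩).sub hint) fun t ht => by
        rw [intervalIntegral.integral_sub (f.intervalIntegrable ht)
          ((hl.intervalIntegrable_inv 0 t).smul_continuousOn hcont.continuousOn),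
          ← hsub t ht, ← prim_eq_intervalIntegral f ht, hf t ht, sub_self]
    rw [ae_restrict_iff' measurableSet_Ioo]
    filter_upwards [key] with s h1 h2
    rw [sub_eq_zero.1 (h1 h2), ← Complex.coe_smul, smul_smul]
    norm_cast
    rw [mul_inv_cancel₀ (hl.lam_pos s).ne']
    simp

end transport

/-! ### Travelling waves -/

/-- Square integrability on bounded intervals of the line. -/
def LocSq {n : ℕ} (g : ℝ → Vec n) : Prop :=
  ∀ a b : ℝ, MemLp g 2 (volume.restrict (Ioc a b))

section LocSq

variable {n k : ℕ} {g g' : ℝ → Vec n}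

theorem LocSq.of_memLp (hg : MemLp g 2 volume) : LocSq g := fun _ _ => hg.restrict _

theorem LocSq.intervalIntegrable (hg : LocSq g) (a b : ℝ) : IntervalIntegrable g volume a b :=
  ⟨(hg a b).integrable (by norm_num), (hg b a).integrable (by norm_num)⟩

theorem LocSq.add (hg : LocSq g) (hg' : LocSq g') : LocSq fun x => g x + g' x :=
  fun a b => (hg a b).add (hg' a b)

theorem LocSq.map (L : Vec n →L[ℂ] Vec k) (hg : LocSq g) : LocSq fun x => L (g x) :=
  fun a b => L.comp_memLp' (hg a b)

theorem LocSq.shift (hg : LocSq g) (c : ℝ) : LocSq fun x => g (x - c) := fun a b => by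
  have h := (hg (a - c) (b - c)).comp_measurePreserving
    ((measurePreserving_sub_right volume c).restrict_preimage measurableSet_Ioc)
  have hpre : (fun x => x - c) ⁻¹' Ioc (a - c) (b - c) = Ioc a b := by
    ext x; simp
  rwa [hpre] at h

theorem LocSq.indicator (hg : LocSq g) {s : Set ℝ} (hs : MeasurableSet s) :
    LocSq (s.indicator g) := fun a b => (hg a b).indicator hs

theorem LocSq.memLp_indicator (hg : LocSq g) (a b : ℝ) :
    MemLp ((Ioc a b).indicator g) 2 volume :=
  (memLp_indicator_iff_restrict measurableSet_Ioc).2 (hg a b)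

theorem LocSq.of_eqOn (h : ∀ a b : ℝ, ∃ g', LocSq g' ∧ EqOn g g' (Ioc a b)) : LocSq g :=
  fun a b => by
    obtain ⟨g', h1, h2⟩ := h a b
    exact (memLp_congr_ae ((ae_restrict_iff' measurableSet_Ioc).2
      (Eventually.of_forall h2))).2 (h1 a b)

theorem LocSq.locL2 (hg : LocSq g) : LocL2 g := fun T => hg 0 T

/-- An input is controlled only at positive times; cutting it off makes it an admissible forcing on
the whole line. -/
theorem LocL2.locSq_indicator (hg : LocL2 g) : LocSq ((Ioi (0 : ℝ)).indicator g) := fun a b => by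
  rw [memLp_indicator_iff_restrict measurableSet_Ioi, Measure.restrict_restrict measurableSet_Ioi]
  exact (hg b).mono_measure (Measure.restrict_mono
    (show Ioi 0 ∩ Ioc a b ⊆ Ioc 0 b from fun x hx => ⟨hx.1, hx.2.2⟩) le_rfl)

end LocSq

/-- The wave with profile `g` at the left end point. -/
def waveFun (lam : ℝ → ℝ) {n : ℕ} (g : ℝ → Vec n) (t ζ : ℝ) : Vec n :=
  (lam ζ)⁻¹ • g (t - travel lam ζ)

open Classical in
/-- The state at time `t` of the wave with profile `g`. -/
def waveState (lam : ℝ → ℝ) {n : ℕ} (g : ℝ → Vec n) (t : ℝ) : State n :=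
  -- The default `0` is never taken for `LocSq` profiles, by `SpeedBound.memLp_waveFun`.
  if h : MemLp (waveFun lam g t) 2 unitMeasure then h.toLp else 0

section wave

variable {n : ℕ} {lam : ℝ → ℝ} {m M : ℝ} (hl : SpeedBound lam m M) {g g' : ℝ → Vec n}
include hl

theorem SpeedBound.unitMeasure_le : unitMeasure ≤ ENNReal.ofReal M • slowness lam :=
  Measure.restrict_le_self.trans hl.volume_le_slowness

theorem SpeedBound.eLpNorm_inv_smul_le (f : ℝ → Vec n) :
    eLpNorm (fun ζ => (lam ζ)⁻¹ • f ζ) 2 unitMeasure ≤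
      (ENNReal.ofReal m⁻¹ * ENNReal.ofReal M ^ (2⁻¹ : ℝ)) * eLpNorm f 2 (slowness lam) := by
  have h1 : eLpNorm (fun ζ => (lam ζ)⁻¹ • f ζ) 2 unitMeasure ≤
      ENNReal.ofReal m⁻¹ * eLpNorm f 2 unitMeasure := by
    refine eLpNorm_le_mul_eLpNorm_of_ae_le_mul (Eventually.of_forall fun ζ => ?_) 2
    rw [norm_smul, Real.norm_of_nonneg (inv_nonneg.2 (hl.lam_pos ζ).le)]
    exact mul_le_mul_of_nonneg_right (hl.inv_le ζ) (norm_nonneg _)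
  refine h1.trans ?_
  rw [mul_assoc]
  gcongr
  refine (eLpNorm_mono_measure f hl.unitMeasure_le).trans ?_
  rw [eLpNorm_smul_measure_of_ne_top (by norm_num)]
  simp

theorem SpeedBound.memLp_inv_smul {f : ℝ → Vec n} (hf : MemLp f 2 (slowness lam)) :
    MemLp (fun ζ => (lam ζ)⁻¹ • f ζ) 2 unitMeasure := by
  refine ⟨?_, ?_⟩
  · have h : AEStronglyMeasurable f unitMeasure :=
      hf.1.mono_ac ((Measure.absolutelyContinuous_of_le Measure.restrict_le_self).trans
        hl.volume_absolutelyContinuous)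
    exact hl.measurable.inv.aestronglyMeasurable.smul h
  · exact (hl.eLpNorm_inv_smul_le f).trans_lt (ENNReal.mul_lt_top (ENNReal.mul_lt_top
      ENNReal.ofReal_lt_top (ENNReal.rpow_lt_top_of_nonneg (by norm_num) ENNReal.ofReal_ne_top))
      hf.2)

/-- Multiplication by `λ₀⁻¹` as a map into the state space. -/
def SpeedBound.invMulL (n : ℕ) : Lp (Vec n) 2 (slowness lam) →L[ℂ] State n :=
  LinearMap.mkContinuous
    { toFun := fun f => (hl.memLp_inv_smul (Lp.memLp f)).toLp
      map_add' := fun f g => by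
        rw [← MemLp.toLp_add]
        refine MemLp.toLp_congr _ _ ?_
        have := hl.volume_absolutelyContinuous.ae_le (Lp.coeFn_add f g)
        filter_upwards [ae_restrict_of_ae this] with ζ h
        rw [h, Pi.add_apply, smul_add, Pi.add_apply]
      map_smul' := fun c f => by
        rw [RingHom.id_apply, ← MemLp.toLp_const_smul]
        refine MemLp.toLp_congr _ _ ?_
        have := hl.volume_absolutelyContinuous.ae_le (Lp.coeFn_smul c f)
        filter_upwards [ae_restrict_of_ae this] with ζ h
        simp only [h, Pi.smul_apply]
        rw [smul_comm] }
    (ENNReal.ofReal m⁻¹ * ENNReal.ofReal M ^ (2⁻¹ : ℝ)).toReal fun f => by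
      simp only [LinearMap.coe_mk, AddHom.coe_mk]
      rw [Lp.norm_toLp, Lp.norm_def, ← ENNReal.toReal_mul]
      refine ENNReal.toReal_mono (ENNReal.mul_ne_top (ENNReal.mul_ne_top ENNReal.ofReal_ne_top
        (ENNReal.rpow_ne_top_of_nonneg (by norm_num) ENNReal.ofReal_ne_top))
        (Lp.eLpNorm_ne_top f)) (hl.eLpNorm_inv_smul_le f)

theorem SpeedBound.memLp_waveFun_of_memLp (hg : MemLp g 2 volume) (t : ℝ) :
    MemLp (waveFun lam g t) 2 unitMeasure :=
  hl.memLp_inv_smul (hg.comp_measurePreserving (hl.measurePreserving_delay t))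

theorem SpeedBound.waveFun_ae_eq {t : ℝ}
    (h : ∀ᵐ x, x ∈ Ioo (t - travel lam 1) t → g x = g' x) :
    waveFun lam g t =ᵐ[unitMeasure] waveFun lam g' t := by
  rw [EventuallyEq, ae_restrict_iff' measurableSet_Ioo]
  filter_upwards [hl.ae_delay h t] with ζ h1 h2
  have := hl.travel_mem_Ioo h2
  rw [waveFun, waveFun, h1 ⟨by linarith [this.2], by linarith [this.1]⟩]

/-- Finite propagation: only the window (t - π, t) of the profile is visible at time t. This reduces
locally square integrable profiles to globally square integrable ones. -/
theorem SpeedBound.waveState_congr {t : ℝ}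
    (h : ∀ᵐ x, x ∈ Ioo (t - travel lam 1) t → g x = g' x) :
    waveState lam g t = waveState lam g' t := by
  have h1 := hl.waveFun_ae_eq h
  by_cases h2 : MemLp (waveFun lam g t) 2 unitMeasure
  · have h3 := (memLp_congr_ae h1).1 h2
    rw [waveState, waveState, dif_pos h2, dif_pos h3]
    exact MemLp.toLp_congr _ _ h1
  · have h3 := (memLp_congr_ae h1).not.1 h2
    rw [waveState, waveState, dif_neg h2, dif_neg h3]

theorem SpeedBound.waveState_indicator {a b t : ℝ} (ha : a ≤ t - travel lam 1) (hb : t ≤ b) :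
    waveState lam ((Ioc a b).indicator g) t = waveState lam g t :=
  hl.waveState_congr (Eventually.of_forall fun x hx =>
    indicator_of_mem (show x ∈ Ioc a b from ⟨ha.trans_lt hx.1, hx.2.le.trans hb⟩) _)

theorem SpeedBound.memLp_waveFun (hg : LocSq g) (t : ℝ) :
    MemLp (waveFun lam g t) 2 unitMeasure := by
  refine (memLp_congr_ae (hl.waveFun_ae_eq (Eventually.of_forall fun x hx => ?_))).1
    (hl.memLp_waveFun_of_memLp (hg.memLp_indicator (t - travel lam 1) t) t)
  exact indicator_of_mem (show x ∈ Ioc _ _ from ⟨hx.1, hx.2.le⟩) _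

theorem SpeedBound.waveState_ae (hg : LocSq g) (t : ℝ) :
    waveState lam g t =ᵐ[unitMeasure] waveFun lam g t := by
  rw [waveState, dif_pos (hl.memLp_waveFun hg t)]
  exact MemLp.coeFn_toLp _

/-- Factors the wave into an isometric composition and a bounded multiplication independent of t;
norm bounds and continuity in time both follow from it. -/
theorem SpeedBound.waveState_eq_invMulL (hg : MemLp g 2 volume) (t : ℝ) :
    waveState lam g t = hl.invMulL n
      (Lp.compMeasurePreserving (fun ζ => t - travel lam ζ) (hl.measurePreserving_delay t)
        hg.toLp) := by
  rw [waveState, dif_pos (hl.memLp_waveFun_of_memLp hg t)]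
  refine (MemLp.toLp_congr _ _ ?_ : _ = (hl.memLp_inv_smul (Lp.memLp _)).toLp)
  have h1 := hl.volume_absolutelyContinuous.ae_le
    (Lp.coeFn_compMeasurePreserving hg.toLp (hl.measurePreserving_delay t))
  filter_upwards [ae_restrict_of_ae h1, ae_restrict_of_ae (hl.ae_delay hg.coeFn_toLp t)]
    with ζ h2 h3
  rw [h2, waveFun, Function.comp_apply, h3]

theorem SpeedBound.norm_waveState_le (hg : MemLp g 2 volume) (t : ℝ) :
    ‖waveState lam g t‖ ≤ ‖hl.invMulL n‖ * (eLpNorm g 2 volume).toReal := by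
  rw [hl.waveState_eq_invMulL hg]
  refine ((hl.invMulL n).le_opNorm _).trans ?_
  rw [Lp.norm_compMeasurePreserving, Lp.norm_toLp]

theorem SpeedBound.continuous_waveState_of_memLp (hg : MemLp g 2 volume) :
    Continuous (waveState lam g) := by
  have h : waveState lam g = fun t => hl.invMulL n
      (Lp.compMeasurePreserving (fun ζ => t - travel lam ζ) (hl.measurePreserving_delay t)
        hg.toLp) := funext fun t => hl.waveState_eq_invMulL hg t
  rw [h]
  let F : C(ℝ, C(ℝ, ℝ)) := (ContinuousMap.mk (fun a : ℝ × ℝ => a.1 - travel lam a.2)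
    (continuous_fst.sub (hl.continuous_travel.comp continuous_snd))).curry
  have : IsLocallyFiniteMeasure (slowness lam) := by
    refine ⟨fun x => ⟨Ioc (x - 1) (x + 1), Ioc_mem_nhds (by linarith) (by linarith), ?_⟩⟩
    rw [hl.slowness_Ioc]
    exact ENNReal.ofReal_lt_top
  exact (hl.invMulL n).continuous.comp
    (Continuous.compMeasurePreservingLp continuous_const F.continuous
      (fun t => hl.measurePreserving_delay t) (by norm_num))

theorem SpeedBound.continuous_waveState (hg : LocSq g) : Continuous (waveState lam g) := by
  refine continuous_iff_continuousAt.2 fun t => ?_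
  have h := (hl.continuous_waveState_of_memLp
    (hg.memLp_indicator (t - 1 - travel lam 1) (t + 1))).continuousAt (x := t)
  refine h.congr ?_
  filter_upwards [Ioo_mem_nhds (show t - 1 < t by linarith) (show t < t + 1 by linarith)]
    with s hs
  exact hl.waveState_indicator (by linarith [hs.1]) hs.2.le

theorem SpeedBound.prim_waveState (hg : LocSq g) (t : ℝ) {ζ : ℝ} (hζ : ζ ∈ Icc (0 : ℝ) 1) :
    prim (waveState lam g t) ζ = ∫ r in (t - travel lam ζ)..t, g r := by
  have h1 : ∫ s in (0 : ℝ)..ζ, waveState lam g t s = ∫ s in (0 : ℝ)..ζ, waveFun lam g t s := by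
    refine intervalIntegral.integral_congr_ae ?_
    have h := (ae_restrict_iff' measurableSet_Ioo).1 (hl.waveState_ae hg t)
    filter_upwards [h, Ioo_ae_eq_Ioc (a := (0 : ℝ)) (b := 1) (μ := volume)] with s h1 h2 h3
    rw [uIoc_of_le hζ.1] at h3
    exact h1 ((iff_of_eq h2).2 ⟨h3.1, h3.2.trans hζ.2⟩)
  rw [prim_eq_intervalIntegral _ hζ, h1]
  have h2 := hl.integral_comp_travel (fun r => g (t - r)) hζ.1
  simp only [waveFun]
  rw [h2, intervalIntegral.integral_comp_sub_left, sub_zero]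

/-- With γ a primitive of g, the primitive of the state at time t is γ(t) - γ(t - p(ζ)), so the
claim becomes an identity between integrals of γ. -/
theorem SpeedBound.transportOp_wave (hg : LocSq g) (t : ℝ) :
    TransportOp lam (∫ s in (0 : ℝ)..t, waveState lam g s)
      (waveState lam g t - waveState lam g 0) (∫ s in (0 : ℝ)..t, g s)
      (∫ s in (0 : ℝ)..t, g (s - travel lam 1)) := by
  set γ : ℝ → Vec n := fun x => ∫ s in (0 : ℝ)..x, g s with hγ
  have hi := hg.intervalIntegrable
  have hγc : Continuous γ := intervalIntegral.continuous_primitive hi 0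
  have hγi : ∀ a b, IntervalIntegrable γ volume a b := hγc.intervalIntegrable
  have hsub : ∀ a b, ∫ s in a..b, g s = γ b - γ a := fun a b =>
    (intervalIntegral.integral_interval_sub_left (hi _ _) (hi _ _)).symm
  have hp : ∀ t, ∀ ζ ∈ Icc (0 : ℝ) 1, prim (waveState lam g t) ζ = γ t - γ (t - travel lam ζ) :=
    fun t ζ hζ => by rw [hl.prim_waveState hg t hζ, hsub]
  have h1 : (1 : ℝ) ∈ Icc (0 : ℝ) 1 := ⟨zero_le_one, le_rfl⟩
  rw [hl.transportOp_iff_prim]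
  refine ⟨fun ζ hζ => ?_, ?_⟩
  · rw [prim_intervalIntegral ((hl.continuous_waveState hg).intervalIntegrable _ _)]
    simp only [hp _ ζ hζ]
    set T := travel lam ζ with hT
    have hT0 := hl.travel_mem_Icc hζ
    have e1 : ∫ r in (0 : ℝ)..T, ((∫ s in (0 : ℝ)..t, g s) -
          prim (waveState lam g t - waveState lam g 0) (hl.travelIso.symm r)) =
        ∫ r in (0 : ℝ)..T, (γ (t - r) - γ (0 - r)) := by
      refine intervalIntegral.integral_congr fun r hr => ?_
      rw [uIcc_of_le hT0.1] at hr
      have hr' := hl.symm_mem_Icc (r := r) ⟨hr.1, hr.2.trans hT0.2⟩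
      beta_reduce
      rw [prim_sub, hp t _ hr', hp 0 _ hr', hl.travel_symm]
      have : γ 0 = 0 := by simp [hγ]
      rw [this]
      change γ t - _ = _
      abel
    have c1 : Continuous fun s => γ (s - T) := hγc.comp (continuous_id.sub continuous_const)
    have c2 : Continuous fun s => γ (t - s) := hγc.comp (continuous_const.sub continuous_id)
    have c3 : Continuous fun s => γ (0 - s) := hγc.comp (continuous_const.sub continuous_id)
    rw [e1, intervalIntegral.integral_sub (hγi _ _) (c1.intervalIntegrable _ _),
      intervalIntegral.integral_sub (c2.intervalIntegrable _ _) (c3.intervalIntegrable _ _),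
      intervalIntegral.integral_comp_sub_right, intervalIntegral.integral_comp_sub_left,
      intervalIntegral.integral_comp_sub_left]
    -- The integral of γ over [-T, t] is split once at 0 and once at t - T.
    have d1 := intervalIntegral.integral_add_adjacent_intervals (hγi (0 - T) 0) (hγi 0 t)
    have d2 := intervalIntegral.integral_add_adjacent_intervals (hγi (0 - T) (t - T))
      (hγi (t - T) t)
    simp only [sub_zero]
    rw [sub_eq_sub_iff_add_eq_add, add_comm, d1, ← d2, add_comm]
  · rw [intervalIntegral.integral_comp_sub_right, hsub, prim_sub, hp t 1 h1, hp 0 1 h1]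
    have : γ 0 = 0 := by simp [hγ]
    rw [this]
    change _ = γ t - _
    abel

end wave

/-! ### Waves with zero initial data -/

section transport_unique

variable {E : Type*} [NormedAddCommGroup E] [NormedSpace ℝ E]

/-- If a continuous function `h` satisfies the transport equation after integration, its
time integral is constant along the characteristics. -/
theorem potential_characteristic {p : ℝ} {h : ℝ → ℝ → E}
    (hc : Continuous fun q : ℝ × ℝ => h q.1 q.2)
    (hN : ∀ r ∈ Icc 0 p, ∀ t, 0 ≤ t → ∫ s in (0 : ℝ)..t, h r s =
      (∫ s in (0 : ℝ)..t, h 0 s) - ∫ ρ in (0 : ℝ)..r, h ρ t)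
    {r t : ℝ} (hr : 0 ≤ r) (ht : 0 ≤ t) {d : ℝ} (hd : 0 ≤ d) (hrd : r + d ≤ p) :
    ∫ s in (0 : ℝ)..(t + d), h (r + d) s = ∫ s in (0 : ℝ)..t, h r s := by
  have hrow : ∀ r, Continuous fun s => h r s := fun r =>
    hc.comp (by fun_prop : Continuous fun s : ℝ => (r, s))
  have hcol : ∀ t, Continuous fun ρ => h ρ t := fun t =>
    hc.comp (by fun_prop : Continuous fun ρ : ℝ => (ρ, t))
  set φ : ℝ → E := fun δ => ∫ s in (0 : ℝ)..(t + δ), h (r + δ) s with hφ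
  have hφc : Continuous φ := by
    have h1 : Continuous (Function.uncurry fun (δ s : ℝ) => h (r + δ) s) :=
      hc.comp (by fun_prop : Continuous fun q : ℝ × ℝ => (r + q.1, q.2))
    exact intervalIntegral.continuous_parametric_intervalIntegral_of_continuous h1 (by fun_prop)
  have key := constant_of_has_deriv_right_zero (f := φ) (a := 0) (b := d) hφc.continuousOn
    fun δ hδ => ?_
  · simpa [hφ] using key d ⟨hd, le_rfl⟩
  rw [hasDerivWithinAt_iff_isLittleO, Asymptotics.isLittleO_iff]
  intro ε hε
  have hcont := hc.continuousAt (x := (r + δ, t + δ))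
  obtain ⟨η, hη, hball⟩ := Metric.continuousAt_iff.1 hcont (ε / 2) (half_pos hε)
  have hev : ∀ᶠ x in 𝓝[Ici δ] δ, x ∈ Ico δ (min (δ + η) d) :=
    Ico_mem_nhdsGE (lt_min (by linarith) hδ.2)
  filter_upwards [hev] with x hx
  have hxη : x < δ + η := hx.2.trans_le (min_le_left _ _)
  have hxd : x < d := hx.2.trans_le (min_le_right _ _)
  -- The diagonal increment is a time increment at position r + x plus a space increment at time t +
  -- δ. The equation turns the latter into minus an integral of h, and continuity makes the
  -- difference o(x - δ).
  have e1 : φ x - φ δ = ∫ y in δ..x, (h (r + x) (t + y) - h (r + y) (t + δ)) := by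
    have i1 := intervalIntegral.integral_interval_sub_left
      ((hrow (r + x)).intervalIntegrable (μ := volume) 0 (t + x))
      ((hrow (r + x)).intervalIntegrable 0 (t + δ))
    have i2 := intervalIntegral.integral_interval_sub_left
      ((hcol (t + δ)).intervalIntegrable (μ := volume) 0 (r + x))
      ((hcol (t + δ)).intervalIntegrable 0 (r + δ))
    have j1 := hN (r + x) ⟨by linarith [hδ.1, hx.1], by linarith⟩ (t + δ) (by linarith [hδ.1])
    have j2 := hN (r + δ) ⟨by linarith [hδ.1], by linarith [hδ.2]⟩ (t + δ) (by linarith [hδ.1])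
    rw [intervalIntegral.integral_sub, intervalIntegral.integral_comp_add_left (h (r + x)),
      intervalIntegral.integral_comp_add_left (fun y => h y (t + δ)), ← i1, ← i2, j1]
    · simp only [hφ]
      rw [j2]
      abel
    · exact ((hrow (r + x)).comp (continuous_const.add continuous_id)).intervalIntegrable _ _
    · exact ((hcol (t + δ)).comp (continuous_const.add continuous_id)).intervalIntegrable _ _
  rw [smul_zero, sub_zero, e1, Real.norm_eq_abs]
  refine intervalIntegral.norm_integral_le_of_norm_le_const fun y hy => ?_
  rw [uIoc_of_le hx.1] at hy
  have b1 : dist (h (r + x) (t + y)) (h (r + δ) (t + δ)) < ε / 2 := by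
    refine hball (x := (r + x, t + y)) ?_
    rw [Prod.dist_eq, Real.dist_eq, Real.dist_eq, max_lt_iff, abs_lt, abs_lt]
    refine ⟨⟨?_, ?_⟩, ?_, ?_⟩ <;> linarith [hx.1, hy.1, hy.2]
  have b2 : dist (h (r + y) (t + δ)) (h (r + δ) (t + δ)) < ε / 2 := by
    refine hball (x := (r + y, t + δ)) ?_
    rw [Prod.dist_eq, Real.dist_eq, Real.dist_eq, max_lt_iff, abs_lt, abs_lt]
    refine ⟨⟨?_, ?_⟩, ?_, ?_⟩ <;> linarith [hx.1, hy.1, hy.2]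
  rw [← dist_eq_norm]
  linarith [dist_triangle_right (h (r + x) (t + y)) (h (r + y) (t + δ)) (h (r + δ) (t + δ))]

/-- Here k is the spatial primitive of the state in travel time and b the integrated trace at 0, so
b - k is the time integral of λ₀z. Its own time integral is constant along characteristics;
differentiating that in t gives the formula. -/
theorem transport_zero_initial [CompleteSpace E] {p : ℝ} (hp : 0 < p) {k : ℝ → ℝ → E} {b : ℝ → E}
    (hk : Continuous fun q : ℝ × ℝ => k q.1 q.2) (hk0 : ∀ t, k 0 t = 0)
    (h : ∀ r ∈ Icc 0 p, ∀ t, 0 ≤ t →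
      ∫ s in (0 : ℝ)..t, k r s = ∫ ρ in (0 : ℝ)..r, (b t - k ρ t))
    (hk00 : ∀ r, k r 0 = 0) {r : ℝ} (hr : r ∈ Icc 0 p) {t : ℝ} (ht : 0 ≤ t) :
    b t - k r t = if r ≤ t then b (t - r) else 0 := by
  have hrow : ∀ r, Continuous fun s => k r s := fun r =>
    hk.comp (by fun_prop : Continuous fun s : ℝ => (r, s))
  have hcol : ∀ t, Continuous fun ρ => k ρ t := fun t =>
    hk.comp (by fun_prop : Continuous fun ρ : ℝ => (ρ, t))
  -- No regularity of b is given; the equation at r = p, solved for b, shows that b agrees for t ≥ 0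
  -- with this continuous function.
  set β : ℝ → E := fun t => p⁻¹ • ((∫ s in (0 : ℝ)..t, k p s) + ∫ ρ in (0 : ℝ)..p, k ρ t) with hβ
  have hbβ : ∀ t, 0 ≤ t → b t = β t := fun t ht => by
    have h1 := h p ⟨hp.le, le_rfl⟩ t ht
    rw [intervalIntegral.integral_sub intervalIntegrable_const ((hcol t).intervalIntegrable _ _),
      intervalIntegral.integral_const, sub_zero] at h1
    rw [hβ]
    beta_reduce
    rw [h1, sub_add_cancel, smul_smul, inv_mul_cancel₀ hp.ne', one_smul]
  have hβc : Continuous β := by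
    refine continuous_const.smul ((intervalIntegral.continuous_primitive
      (fun _ _ => (hrow p).intervalIntegrable _ _) 0).add ?_)
    exact intervalIntegral.continuous_parametric_intervalIntegral_of_continuous'
      (f := fun t ρ => k ρ t) (hk.comp continuous_swap) 0 p
  set H : ℝ → ℝ → E := fun r t => β t - k r t with hH
  have hHc : Continuous fun q : ℝ × ℝ => H q.1 q.2 := (hβc.comp continuous_snd).sub hk
  have hHrow : ∀ r, Continuous (H r) := fun r => hβc.sub (hrow r)
  have hN : ∀ r ∈ Icc 0 p, ∀ t, 0 ≤ t → ∫ s in (0 : ℝ)..t, H r s =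
      (∫ s in (0 : ℝ)..t, H 0 s) - ∫ ρ in (0 : ℝ)..r, H ρ t := fun r hr t ht => by
    simp only [hH, hk0, sub_zero]
    rw [intervalIntegral.integral_sub (hβc.intervalIntegrable _ _)
      ((hrow r).intervalIntegrable _ _), h r hr t ht, hbβ t ht]
  have hβ0 : β 0 = 0 := by simp [hβ, hk00]
  rw [hbβ t ht]
  change H r t = _
  have hder : ∀ r t, HasDerivAt (fun t => ∫ s in (0 : ℝ)..t, H r s) (H r t) t := fun r t =>
    (hHrow r).integral_hasStrictDerivAt 0 t |>.hasDerivAt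
  have hlate : ∀ s, r < s → H r s = β (s - r) := fun s hs => by
    have e : ∀ x, r < x → ∫ y in (0 : ℝ)..x, H r y = ∫ y in (0 : ℝ)..(x - r), H 0 y :=
      fun x hx => by
        simpa using potential_characteristic hHc hN (r := 0) (t := x - r) le_rfl
          (by linarith) hr.1 (by linarith [hr.2])
    have d2 : HasDerivAt (fun x => ∫ y in (0 : ℝ)..(x - r), H 0 y) (H 0 (s - r)) s :=
      (hder 0 (s - r)).comp_sub_const s r
    have := (hder r s).unique (d2.congr_of_eventuallyEq
      (by filter_upwards [lt_mem_nhds hs] with x hx using e x hx))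
    simpa [hH, hk0] using this
  have hearly : ∀ s, 0 < s → s < r → H r s = 0 := fun s hs hsr => by
    have e : ∀ x, 0 < x → x < r → ∫ y in (0 : ℝ)..x, H r y = 0 := fun x hx hxr => by
      simpa using potential_characteristic hHc hN (r := r - x) (t := 0) (by linarith) le_rfl
        hx.le (by linarith [hr.2])
    exact (hder r s).unique ((hasDerivAt_const s (0 : E)).congr_of_eventuallyEq
      (by filter_upwards [Ioo_mem_nhds hs hsr] with x hx using e x hx.1 hx.2))
  split_ifs with hrt
  · rw [hbβ _ (sub_nonneg.2 hrt)]
    rcases hrt.lt_or_eq with hlt | rfl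
    · exact hlate t hlt
    · have c1 : Tendsto (H r) (𝓝[>] r) (𝓝 (H r r)) := ((hHrow r).tendsto r).mono_left inf_le_left
      have c2 : Tendsto (fun s => β (s - r)) (𝓝[>] r) (𝓝 (β (r - r))) :=
        ((hβc.comp (continuous_id.sub continuous_const)).tendsto r).mono_left inf_le_left
      refine tendsto_nhds_unique c1 (c2.congr' ?_)
      filter_upwards [self_mem_nhdsWithin] with s hs using (hlate s hs).symm
  · rcases ht.lt_or_eq with hlt | rfl
    · exact hearly t hlt (not_le.1 hrt)
    · simp [hH, hβ0, hk00]

end transport_unique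

section zero_initial

variable {n : ℕ} {lam : ℝ → ℝ} {m M : ℝ} (hl : SpeedBound lam m M)
include hl

/-- Mild solutions of the transport equation with zero initial state: the trace at `1` is the
delayed trace at `0`, and the state vanishes as long as the trace at `0` does. -/
theorem SpeedBound.zero_initial {z : ℝ → State n} (hz : ContinuousOn z (Ici 0)) (hz0 : z 0 = 0)
    {b₀ b₁ : ℝ → Vec n}
    (h : ∀ t, 0 ≤ t → TransportOp lam (∫ s in (0 : ℝ)..t, z s) (z t) (b₀ t) (b₁ t)) :
    (∀ t, 0 ≤ t → b₁ t = if travel lam 1 ≤ t then b₀ (t - travel lam 1) else 0) ∧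
    ∀ T, (∀ t ∈ Icc 0 T, b₀ t = 0) → ∀ t ∈ Icc 0 T, z t = 0 := by
  -- Values at negative times are arbitrary, so the path is frozen there to make it continuous on
  -- the line.
  have hzc : Continuous fun t => z (max t 0) :=
    hz.comp_continuous (by fun_prop) fun t => mem_Ici.2 (le_max_right _ _)
  have hzi : ∀ t, 0 ≤ t → IntervalIntegrable z volume 0 t := fun t ht =>
    ContinuousOn.intervalIntegrable (by
      rw [uIcc_of_le ht]; exact hz.mono fun x hx => hx.1)
  have key : ∀ r ∈ Icc 0 (travel lam 1), ∀ t, 0 ≤ t →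
      b₀ t - prim (z t) (hl.travelIso.symm r) = if r ≤ t then b₀ (t - r) else 0 := by
    intro r hr t ht
    have h1 := transport_zero_initial hl.travel_one_pos
      (k := fun r t => prim (z (max t 0)) (hl.travelIso.symm r)) (b := b₀)
      ((continuous_prim_path hzc).comp
        ((hl.continuous_symm.comp continuous_fst).prodMk continuous_snd))
      (fun t => by
        have : hl.travelIso.symm 0 = 0 := by
          rw [← travel_zero (lam := lam), hl.symm_travel, travel_zero]
        simp [this])
      (fun r hr t ht => ?_) (fun r => by simp [hz0]) hr ht
    · simpa [max_eq_left ht] using h1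
    · have h2 := ((hl.transportOp_iff_prim).1 (h t ht)).1 _ (hl.symm_mem_Icc hr)
      rw [prim_intervalIntegral (hzi t ht), hl.travel_symm] at h2
      simp only [max_eq_left ht]
      rw [← h2]
      refine intervalIntegral.integral_congr fun s hs => ?_
      rw [uIcc_of_le ht] at hs
      rw [max_eq_left hs.1]
  refine ⟨fun t ht => ?_, fun T hT t ht => ?_⟩
  · rw [← key _ ⟨hl.travel_one_pos.le, le_rfl⟩ t ht, hl.symm_travel]
    exact ((transportOp_iff).1 (h t ht)).2
  · refine prim_injective fun ζ hζ => ?_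
    have h1 := key _ (hl.travel_mem_Icc hζ) t ht.1
    rw [hl.symm_travel, hT t ht] at h1
    have h2 : (if travel lam ζ ≤ t then b₀ (t - travel lam ζ) else 0) = 0 := by
      split_ifs with hle
      · exact hT _ ⟨sub_nonneg.2 hle, by linarith [ht.2, (hl.travel_mem_Icc hζ).1]⟩
      · rfl
    rw [h2] at h1
    rw [prim_zero]
    simpa using h1

end zero_initial

/-! ### Matrices as bounded operators -/

/-- Multiplication by a matrix. -/
def mv {a b : ℕ} (A : Matrix (Fin a) (Fin b) ℂ) : Vec b →L[ℂ] Vec a :=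
  LinearMap.toContinuousLinearMap
    ((WithLp.linearEquiv 2 ℂ (Fin a → ℂ)).symm.toLinearMap ∘ₗ A.mulVecLin ∘ₗ
      (WithLp.linearEquiv 2 ℂ (Fin b → ℂ)).toLinearMap)

@[simp] theorem mv_ofLp {a b : ℕ} (A : Matrix (Fin a) (Fin b) ℂ) (x : Vec b) :
    (mv A x).ofLp = A *ᵥ x.ofLp := rfl

theorem mv_mul {a b c : ℕ} (A : Matrix (Fin a) (Fin b) ℂ) (B : Matrix (Fin b) (Fin c) ℂ)
    (x : Vec c) : mv (A * B) x = mv A (mv B x) := by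
  refine WithLp.ofLp_injective 2 ?_
  simp [Matrix.mulVec_mulVec]

@[simp] theorem mv_one {a : ℕ} (x : Vec a) : mv (1 : Matrix (Fin a) (Fin a) ℂ) x = x := by
  refine WithLp.ofLp_injective 2 ?_
  simp

theorem mv_neg {a b : ℕ} (A : Matrix (Fin a) (Fin b) ℂ) (x : Vec b) : mv (-A) x = -mv A x := by
  refine WithLp.ofLp_injective 2 ?_
  simp [Matrix.neg_mulVec]

/-- Every linear map between the spaces `ℂⁿ` is given by a matrix. -/
theorem exists_mv_eq {a b : ℕ} (L : Vec b →ₗ[ℂ] Vec a) :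
    ∃ A : Matrix (Fin a) (Fin b) ℂ, ∀ x, mv A x = L x := by
  refine ⟨LinearMap.toMatrix' ((WithLp.linearEquiv 2 ℂ (Fin a → ℂ)).toLinearMap ∘ₗ L ∘ₗ
      (WithLp.linearEquiv 2 ℂ (Fin b → ℂ)).symm.toLinearMap), fun x => ?_⟩
  refine WithLp.ofLp_injective 2 ?_
  rw [mv_ofLp, LinearMap.toMatrix'_mulVec]
  simp

namespace PortSystem

variable {n c p m : ℕ}

theorem boundary_iff (S : PortSystem n c p m) {b₀ b₁ : Vec n} {u : Vec p} {y : Vec m} :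
    S.Boundary b₀ b₁ u y ↔ mv S.K₀ b₀ + mv S.L₀ b₁ = 0 ∧ mv S.Ku b₀ + mv S.Lu b₁ = u ∧
      mv S.Ky b₀ + mv S.Ly b₁ = y := by
  rw [Boundary, ← (WithLp.ofLp_injective 2).eq_iff, ← (WithLp.ofLp_injective 2).eq_iff,
    ← (WithLp.ofLp_injective 2).eq_iff]
  simp

theorem Boundary.sub {S : PortSystem n c p m} {b₀ b₁ b₀' b₁' : Vec n} {u u' : Vec p}
    {y y' : Vec m} (h : S.Boundary b₀ b₁ u y) (h' : S.Boundary b₀' b₁' u' y') :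
    S.Boundary (b₀ - b₀') (b₁ - b₁') (u - u') (y - y') := by
  rw [boundary_iff] at *
  simp only [map_sub, ← h.2.1, ← h'.2.1, ← h.2.2, ← h'.2.2]
  refine ⟨?_, by abel, by abel⟩
  rw [sub_add_sub_comm, h.1, h'.1, sub_zero]

end PortSystem

/-! ### Waves as mild solutions -/

theorem ae_Ioc_of_ae_Ioi {P : ℝ → Prop} (h : ∀ᵐ t, 0 < t → P t) {T : ℝ} (hT : 0 ≤ T) :
    ∀ᵐ t, t ∈ uIoc 0 T → P t := by
  filter_upwards [h] with t ht h2
  rw [uIoc_of_le hT] at h2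
  exact ht h2.1

theorem integral_mv_add {n a : ℕ} {K L : Matrix (Fin a) (Fin n) ℂ} {g h : ℝ → Vec n}
    {v : ℝ → Vec a} (hg : LocSq g) (hh : LocSq h)
    (hv : ∀ᵐ t, 0 < t → mv K (g t) + mv L (h t) = v t) {t : ℝ} (ht : 0 ≤ t) :
    mv K (∫ s in (0 : ℝ)..t, g s) + mv L (∫ s in (0 : ℝ)..t, h s) = ∫ s in (0 : ℝ)..t, v s := by
  have hi := hg.intervalIntegrable 0 t
  have hj := hh.intervalIntegrable 0 t
  rw [← (mv K).intervalIntegral_comp_comm hi, ← (mv L).intervalIntegral_comp_comm hj,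
    ← intervalIntegral.integral_add ((hg.map (mv K)).intervalIntegrable 0 t)
      ((hh.map (mv L)).intervalIntegrable 0 t)]
  exact intervalIntegral.integral_congr_ae (ae_Ioc_of_ae_Ioi hv ht)

section wave

variable {n c p k : ℕ} {lam : ℝ → ℝ} {m M : ℝ} (hl : SpeedBound lam m M)
include hl

/-- The integrated traces of a wave are the integrals of g and of its delay, so pointwise boundary
relations need only be integrated in time. -/
theorem SpeedBound.isMildSolution_wave (S : PortSystem n c p k) {g : ℝ → Vec n} (hg : LocSq g)
    {u : ℝ → Vec p} {y : ℝ → Vec k} (hu : LocL2 u) (hy : LocL2 y)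
    (hb : ∀ᵐ t, 0 < t → S.Boundary (g t) (g (t - travel lam 1)) (u t) (y t)) :
    S.IsMildSolution lam (waveState lam g) u y := by
  refine ⟨(hl.continuous_waveState hg).continuousOn, hu, hy, fun t ht =>
    ⟨_, _, hl.transportOp_wave hg t, ?_⟩⟩
  simp only [PortSystem.boundary_iff] at hb ⊢
  refine ⟨?_, integral_mv_add hg (hg.shift _) ?_ ht, integral_mv_add hg (hg.shift _) ?_ ht⟩
  · rw [integral_mv_add hg (hg.shift _) (v := fun _ => 0) _ ht, intervalIntegral.integral_zero]
    filter_upwards [hb] with s hs h0 using (hs h0).1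
  · filter_upwards [hb] with s hs h0 using (hs h0).2.1
  · filter_upwards [hb] with s hs h0 using (hs h0).2.2

/-- The profile at negative times of the wave with initial state `z`. -/
def SpeedBound.profile (z : State n) : ℝ → Vec n :=
  (Ioo (-travel lam 1) 0).indicator fun x =>
    lam (hl.travelIso.symm (-x)) • z (hl.travelIso.symm (-x))

theorem SpeedBound.profile_delay (z : State n) (ζ : ℝ) :
    hl.profile z (0 - travel lam ζ) = (Ioo (0 : ℝ) 1).indicator (fun ζ => lam ζ • z ζ) ζ := by
  by_cases h : ζ ∈ Ioo (0 : ℝ) 1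
  · have h2 := hl.travel_mem_Ioo h
    rw [indicator_of_mem h, profile, indicator_of_mem
      (show 0 - travel lam ζ ∈ Ioo (-travel lam 1) 0 from ⟨by linarith [h2.2], by linarith [h2.1]⟩)]
    simp
  · rw [indicator_of_notMem h, profile, indicator_of_notMem]
    rintro ⟨h1, h2⟩
    refine h ⟨?_, ?_⟩
    · rw [← hl.travel_strictMono.lt_iff_lt, travel_zero]; linarith
    · rw [← hl.travel_strictMono.lt_iff_lt]; linarith

theorem SpeedBound.slowness_le : slowness lam ≤ ENNReal.ofReal m⁻¹ • volume := by
  rw [← withDensity_const, slowness]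
  exact withDensity_mono (Eventually.of_forall fun ζ => ENNReal.ofReal_le_ofReal (hl.inv_le ζ))

theorem SpeedBound.exists_profile_bound (n : ℕ) : ∃ C : NNReal, ∀ z : State n,
    AEStronglyMeasurable (hl.profile z) volume ∧
      eLpNorm (hl.profile z) 2 volume ≤ C * eLpNorm z 2 unitMeasure := by
  -- M bounds the factor λ₀; m^(-1/2) comes from λ₀⁻¹dζ ≤ m⁻¹dζ in the L² norm.
  refine ⟨M.toNNReal * (m⁻¹.toNNReal ^ (2⁻¹ : ℝ)), fun z => ?_⟩
  have hσ : Measurable fun x : ℝ => hl.travelIso.symm (-x) :=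
    hl.continuous_symm.measurable.comp measurable_neg
  have hmeas : AEStronglyMeasurable (hl.profile z) volume :=
    (((hl.measurable.comp hσ).stronglyMeasurable.smul
      ((Lp.stronglyMeasurable z).comp_measurable hσ)).indicator
        measurableSet_Ioo).aestronglyMeasurable
  refine ⟨hmeas, ?_⟩
  rw [← eLpNorm_comp_measurePreserving hmeas (hl.measurePreserving_delay 0)]
  have h1 : eLpNorm (hl.profile z ∘ fun ζ => 0 - travel lam ζ) 2 (slowness lam) ≤
      ENNReal.ofReal M * eLpNorm ((Ioo (0 : ℝ) 1).indicator z) 2 (slowness lam) := by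
    refine eLpNorm_le_mul_eLpNorm_of_ae_le_mul (Eventually.of_forall fun ζ => ?_) 2
    rw [Function.comp_apply, hl.profile_delay]
    by_cases h : ζ ∈ Ioo (0 : ℝ) 1
    · rw [indicator_of_mem h, indicator_of_mem h, norm_smul, Real.norm_of_nonneg (hl.lam_pos ζ).le]
      exact mul_le_mul_of_nonneg_right (hl.upper ζ) (norm_nonneg _)
    · rw [indicator_of_notMem h, indicator_of_notMem h]
      simp
  refine h1.trans ?_
  rw [ENNReal.coe_mul, mul_assoc]
  refine mul_le_mul_right ?_ _
  refine (eLpNorm_mono_measure _ hl.slowness_le).trans ?_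
  rw [eLpNorm_smul_measure_of_ne_top (by norm_num), eLpNorm_indicator_eq_eLpNorm_restrict
    measurableSet_Ioo, ENNReal.coe_rpow_of_nonneg _ (by norm_num)]
  simp [ENNReal.ofReal]

theorem SpeedBound.memLp_profile (z : State n) : MemLp (hl.profile z) 2 volume := by
  obtain ⟨C, hC⟩ := hl.exists_profile_bound n
  exact ⟨(hC z).1, (hC z).2.trans_lt (ENNReal.mul_lt_top ENNReal.coe_lt_top
    (Lp.eLpNorm_lt_top z))⟩

theorem SpeedBound.waveState_profile (z : State n) {g : ℝ → Vec n}
    (hg : ∀ x ≤ 0, g x = hl.profile z x) : waveState lam g 0 = z := by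
  rw [hl.waveState_congr (g' := hl.profile z) (Eventually.of_forall fun x hx => hg x hx.2.le)]
  refine Lp.ext ?_
  filter_upwards [hl.waveState_ae (LocSq.of_memLp (hl.memLp_profile z)) 0,
    ae_restrict_mem measurableSet_Ioo] with ζ h1 h2
  rw [h1, waveFun, hl.profile_delay, indicator_of_mem h2, smul_smul,
    inv_mul_cancel₀ (hl.lam_pos ζ).ne', one_smul]

end wave

/-! ### Profiles generated by a delay recursion -/

/-- `j` steps of the recursion `g(x) = A g(x-d) + v(x)`, starting from `g₀`. -/
def delayIter {n : ℕ} (A : Vec n →L[ℂ] Vec n) (d : ℝ) (g₀ v : ℝ → Vec n) : ℕ → ℝ → Vec n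
  | 0, x => g₀ x
  | j + 1, x => A (delayIter A d g₀ v j (x - d)) + v x

/-- The solution of `g(x) = A g(x-d) + v(x)` for `x > 0`, with `g = g₀` on `(-∞,0]`. -/
def delaySol {n : ℕ} (A : Vec n →L[ℂ] Vec n) (d : ℝ) (g₀ v : ℝ → Vec n) (x : ℝ) : Vec n :=
  delayIter A d g₀ v ⌈x / d⌉₊ x

section delay

variable {n : ℕ} {A : Vec n →L[ℂ] Vec n} {d : ℝ} {g₀ v : ℝ → Vec n}

theorem delaySol_of_nonpos (hd : 0 < d) {x : ℝ} (hx : x ≤ 0) :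
    delaySol A d g₀ v x = g₀ x := by
  rw [delaySol, Nat.ceil_eq_zero.2 (div_nonpos_of_nonpos_of_nonneg hx hd.le)]
  rfl

theorem delaySol_of_pos (hd : 0 < d) {x : ℝ} (hx : 0 < x) :
    delaySol A d g₀ v x = A (delaySol A d g₀ v (x - d)) + v x := by
  have h1 : 0 < ⌈x / d⌉₊ := Nat.ceil_pos.2 (div_pos hx hd)
  -- One delay lowers the step count by exactly one. Truncated subtraction is harmless because the
  -- count is positive for x > 0.
  have h2 : ⌈(x - d) / d⌉₊ + 1 = ⌈x / d⌉₊ := by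
    rw [sub_div, div_self hd.ne', Nat.ceil_sub_one, Nat.sub_add_cancel h1]
  rw [delaySol, ← h2]
  rfl

theorem LocSq.delayIter (h₀ : LocSq g₀) (hv : LocSq v) (j : ℕ) :
    LocSq (delayIter A d g₀ v j) := by
  induction j with
  | zero => exact h₀
  | succ j ih => exact ((ih.shift d).map A).add hv

/-- Below T the solution glues finitely many iterates along strips of constant step count;
measurability and L² bounds come from this. -/
theorem delaySol_eq_sum (hd : 0 < d) {T x : ℝ} (hx : x ≤ T) :
    delaySol A d g₀ v x = ∑ j ∈ Finset.range (⌈T / d⌉₊ + 1),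
      {x : ℝ | ⌈x / d⌉₊ = j}.indicator (delayIter A d g₀ v j) x := by
  have hmem : ⌈x / d⌉₊ ∈ Finset.range (⌈T / d⌉₊ + 1) :=
    Finset.mem_range_succ_iff.2 (Nat.ceil_mono (div_le_div_of_nonneg_right hx hd.le))
  rw [Finset.sum_eq_single_of_mem _ hmem]
  · rw [indicator_of_mem (by simp)]
    rfl
  · intro j _ hj
    have : x ∉ {x : ℝ | ⌈x / d⌉₊ = j} := fun h => hj (Eq.symm h)
    exact indicator_of_notMem this _

theorem measurableSet_ceil_eq (d : ℝ) (j : ℕ) : MeasurableSet {x : ℝ | ⌈x / d⌉₊ = j} :=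
  (Nat.measurable_ceil.comp (measurable_id.div_const d)) (measurableSet_singleton j)

theorem LocSq.delaySol (hd : 0 < d) (h₀ : LocSq g₀) (hv : LocSq v) :
    LocSq (delaySol A d g₀ v) := by
  refine LocSq.of_eqOn fun a b => ⟨fun x => ∑ j ∈ Finset.range (⌈b / d⌉₊ + 1),
      {x : ℝ | ⌈x / d⌉₊ = j}.indicator (PortHam.delayIter A d g₀ v j) x, fun a' b' => ?_,
    fun x hx => delaySol_eq_sum hd hx.2⟩
  exact memLp_finsetSum _ fun j _ => (h₀.delayIter hv j).indicator (measurableSet_ceil_eq d j) a' b'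

/-- Without forcing, the solution depends boundedly on the initial profile. -/
theorem exists_delaySol_bound (hd : 0 < d) (A : Vec n →L[ℂ] Vec n) (T : ℝ) :
    ∃ C : NNReal, ∀ g₀ : ℝ → Vec n, MemLp g₀ 2 volume →
      MemLp ((Iic T).indicator (delaySol A d g₀ 0)) 2 volume ∧
      eLpNorm ((Iic T).indicator (delaySol A d g₀ 0)) 2 volume ≤ C * eLpNorm g₀ 2 volume := by
  -- Without forcing, the j-th iterate is A^j applied to a translate of g₀, hence a term ‖A‖^j for
  -- each strip.
  refine ⟨∑ j ∈ Finset.range (⌈T / d⌉₊ + 1), ‖A‖₊ ^ j, fun g₀ h₀ => ?_⟩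
  have hj : ∀ j, MemLp (delayIter A d g₀ 0 j) 2 volume ∧
      eLpNorm (delayIter A d g₀ 0 j) 2 volume ≤ (‖A‖₊ ^ j : NNReal) * eLpNorm g₀ 2 volume := by
    intro j
    induction j with
    | zero => exact ⟨h₀, by simp [delayIter]⟩
    | succ j ih =>
      have e : delayIter A d g₀ 0 (j + 1) = fun x => A (delayIter A d g₀ 0 j (x - d)) := by
        ext1 x
        simp [delayIter]
      have hs : MemLp (fun x => delayIter A d g₀ 0 j (x - d)) 2 volume :=
        ih.1.comp_measurePreserving (measurePreserving_sub_right volume d)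
      rw [e]
      refine ⟨A.comp_memLp' hs, ?_⟩
      calc eLpNorm (fun x => A (delayIter A d g₀ 0 j (x - d))) 2 volume
          ≤ ‖A‖₊ * eLpNorm (fun x => delayIter A d g₀ 0 j (x - d)) 2 volume :=
            eLpNorm_le_nnreal_smul_eLpNorm_of_ae_le_mul
              (Eventually.of_forall fun x => A.le_opNNNorm _) 2
        _ = ‖A‖₊ * eLpNorm (delayIter A d g₀ 0 j) 2 volume := by
            rw [← eLpNorm_comp_measurePreserving ih.1.1 (measurePreserving_sub_right volume d)]
            rfl
        _ ≤ ‖A‖₊ * ((‖A‖₊ ^ j : NNReal) * eLpNorm g₀ 2 volume) := mul_le_mul_right ih.2 _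
        _ = _ := by rw [← mul_assoc, ← ENNReal.coe_mul, pow_succ']
  have e : (Iic T).indicator (delaySol A d g₀ 0) = ∑ j ∈ Finset.range (⌈T / d⌉₊ + 1),
      (Iic T ∩ {x : ℝ | ⌈x / d⌉₊ = j}).indicator (delayIter A d g₀ 0 j) := by
    ext1 x
    rw [Finset.sum_apply]
    by_cases hx : x ∈ Iic T
    · rw [indicator_of_mem hx, delaySol_eq_sum hd hx]
      refine Finset.sum_congr rfl fun j _ => ?_
      rw [← indicator_indicator, indicator_of_mem hx]
    · rw [indicator_of_notMem hx]
      exact (Finset.sum_eq_zero fun j _ => indicator_of_notMem (fun h => hx h.1) _).symm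
  have hm : ∀ j, MeasurableSet (Iic T ∩ {x : ℝ | ⌈x / d⌉₊ = j}) := fun j =>
    measurableSet_Iic.inter (measurableSet_ceil_eq d j)
  rw [e]
  refine ⟨memLp_finsetSum' _ fun j _ => (hj j).1.indicator (hm j), ?_⟩
  refine (eLpNorm_sum_le (fun j _ => ((hj j).1.indicator (hm j)).1) (by norm_num)).trans ?_
  push_cast
  rw [Finset.sum_mul]
  refine Finset.sum_le_sum fun j _ => (eLpNorm_indicator_le _).trans ?_
  simpa using (hj j).2

end delay

/-! ### Paths solving the transport equation -/

/-- Mild solutions of the transport equation with integrated boundary traces `b₀`, `b₁`. -/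
def TransportPath (lam : ℝ → ℝ) {n : ℕ} (z : ℝ → State n) (b₀ b₁ : ℝ → Vec n) : Prop :=
  ContinuousOn z (Ici 0) ∧
    ∀ t, 0 ≤ t → TransportOp lam (∫ s in (0 : ℝ)..t, z s) (z t - z 0) (b₀ t) (b₁ t)

section TransportPath

variable {n : ℕ} {lam : ℝ → ℝ} {z z' : ℝ → State n} {b₀ b₁ b₀' b₁' : ℝ → Vec n}

theorem intervalIntegrable_of_continuousOn_Ici {E : Type*} [NormedAddCommGroup E] {z : ℝ → E}
    (hz : ContinuousOn z (Ici 0)) {t : ℝ} (ht : 0 ≤ t) : IntervalIntegrable z volume 0 t :=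
  ContinuousOn.intervalIntegrable (by
    rw [uIcc_of_le ht]
    exact hz.mono fun x hx => hx.1)

theorem TransportPath.sub (h : TransportPath lam z b₀ b₁) (h' : TransportPath lam z' b₀' b₁') :
    TransportPath lam (fun t => z t - z' t) (fun t => b₀ t - b₀' t) fun t => b₁ t - b₁' t := by
  refine ⟨h.1.sub h'.1, fun t ht => ?_⟩
  rw [intervalIntegral.integral_sub (intervalIntegrable_of_continuousOn_Ici h.1 ht)
    (intervalIntegrable_of_continuousOn_Ici h'.1 ht), sub_sub_sub_comm]
  exact (h.2 t ht).sub (h'.2 t ht)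

theorem SpeedBound.transportPath_wave {m M : ℝ} (hl : SpeedBound lam m M) {g : ℝ → Vec n}
    (hg : LocSq g) : TransportPath lam (waveState lam g) (fun t => ∫ s in (0 : ℝ)..t, g s)
      fun t => ∫ s in (0 : ℝ)..t, g (s - travel lam 1) :=
  ⟨(hl.continuous_waveState hg).continuousOn, fun t _ => hl.transportOp_wave hg t⟩

theorem PortSystem.IsMildSolution.exists_transportPath {c p m : ℕ} {S : PortSystem n c p m}
    {u : ℝ → Vec p} {y : ℝ → Vec m} (h : S.IsMildSolution lam z u y) :
    ∃ b₀ b₁, TransportPath lam z b₀ b₁ ∧ ∀ t, 0 ≤ t →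
      S.Boundary (b₀ t) (b₁ t) (∫ s in (0 : ℝ)..t, u s) (∫ s in (0 : ℝ)..t, y s) := by
  choose! b₀ b₁ hb using h.2.2.2
  exact ⟨b₀, b₁, ⟨h.1, fun t ht => (hb t ht).1⟩, fun t ht => (hb t ht).2⟩

theorem TransportPath.zero_initial {m M : ℝ} (hl : SpeedBound lam m M)
    (h : TransportPath lam z b₀ b₁) (hz : z 0 = 0) :
    (∀ t, 0 ≤ t → b₁ t = if travel lam 1 ≤ t then b₀ (t - travel lam 1) else 0) ∧
    ∀ T, (∀ t ∈ Icc 0 T, b₀ t = 0) → ∀ t ∈ Icc 0 T, z t = 0 :=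
  hl.zero_initial h.1 hz fun t ht => by simpa [hz] using h.2 t ht

end TransportPath

/-! ### Exponential solutions and the boundary operator -/

theorem LocSq.of_continuous {n : ℕ} {g : ℝ → Vec n} (hg : Continuous g) : LocSq g := fun a b => by
  obtain ⟨C, hC⟩ := isCompact_Icc.exists_bound_of_continuousOn (hg.continuousOn (s := Icc a b))
  refine MemLp.of_bound hg.aestronglyMeasurable C ?_
  filter_upwards [ae_restrict_mem measurableSet_Ioc] with x hx
  exact hC x ⟨hx.1.le, hx.2⟩

section boundary

variable {n c p k : ℕ} {lam : ℝ → ℝ} {m M : ℝ} (hl : SpeedBound lam m M)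
include hl

/-- The state is that of the wave with profile e^{sx} b at time 0; its trace at 1 is the profile
value one travel time earlier. -/
theorem SpeedBound.transportOp_exp (s : ℂ) (b : Vec n) :
    ∃ x : State n, TransportOp lam x (s • x) b (Complex.exp (-(s * travel lam 1)) • b) := by
  set g : ℝ → Vec n := fun x => Complex.exp (s * x) • b with hg
  have hgc : Continuous g := by fun_prop
  have hder : ∀ x, HasDerivAt g (s • g x) x := fun x => by
    have h1 : HasDerivAt (fun x : ℝ => Complex.exp (s * x)) (Complex.exp (s * x) * (s * 1)) x :=
      ((Complex.ofRealCLM.hasDerivAt (x := x)).const_mul s).cexp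
    have h2 := h1.smul_const b
    rwa [mul_one, mul_comm, mul_smul] at h2
  have hint : ∀ r, s • ∫ x in (0 - r)..0, g x = b - g (0 - r) := fun r => by
    rw [← intervalIntegral.integral_smul, intervalIntegral.integral_eq_sub_of_hasDerivAt
      (fun x _ => hder x) ((hgc.const_smul s).intervalIntegrable _ _)]
    simp [hg]
  have hloc := LocSq.of_continuous hgc
  have hprim : ∀ ζ ∈ Icc (0 : ℝ) 1, prim (s • waveState lam g 0) ζ = b - g (0 - travel lam ζ) :=
    fun ζ hζ => by rw [prim_smul, hl.prim_waveState hloc 0 hζ, hint]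
  refine ⟨waveState lam g 0, (hl.transportOp_iff_prim).2 ⟨fun ζ hζ => ?_, ?_⟩⟩
  · have hT := hl.travel_mem_Icc hζ
    have e : ∫ r in (0 : ℝ)..travel lam ζ,
        (b - prim (s • waveState lam g 0) (hl.travelIso.symm r)) =
        ∫ r in (0 : ℝ)..travel lam ζ, g (0 - r) := by
      refine intervalIntegral.integral_congr fun r hr => ?_
      rw [uIcc_of_le hT.1] at hr
      beta_reduce
      rw [hprim _ (hl.symm_mem_Icc ⟨hr.1, hr.2.trans hT.2⟩), hl.travel_symm, sub_sub_cancel]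
    rw [hl.prim_waveState hloc 0 hζ, e, intervalIntegral.integral_comp_sub_left, sub_zero]
  · rw [hprim 1 ⟨zero_le_one, le_rfl⟩, sub_sub_cancel]
    simp [hg]

omit hl in
/-- On the resolvent set there are no exponential solutions without input. -/
theorem PortSystem.traces_eq_zero {S : PortSystem n c p k} {s : ℂ} (hs : s ∈ S.resolventSet lam)
    {x : State n} {b₀ b₁ : Vec n} {y : Vec k} (hx : TransportOp lam x (s • x) b₀ b₁)
    (hb : S.Boundary b₀ b₁ 0 y) : b₀ = 0 ∧ b₁ = 0 := by
  obtain ⟨R, hR⟩ := hs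
  have h0 : x = R 0 := (hR x 0).1 ⟨b₀, b₁, by simpa using hx, y, hb⟩
  rw [map_zero] at h0
  subst h0
  refine hx.trace_unique (transportOp_iff.2 ⟨?_, ?_⟩)
  · filter_upwards [Lp.coeFn_zero (Vec n) 2 unitMeasure] with ζ h
    rw [h]
    simp
  · simp

/-- The boundary values of well-posed systems with zero input can be prescribed at `1`. -/
theorem PortSystem.WellPosed.exists_boundary {S : PortSystem n c p k} (hS : S.WellPosed lam)
    (v : Vec n) : ∃ b, mv S.K₀ b + mv S.L₀ v = 0 ∧ mv S.Ku b + mv S.Lu v = 0 := by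
  set g : ℝ → Vec n := fun _ => v
  have hg : LocSq g := LocSq.of_continuous continuous_const
  obtain ⟨z, y, hz, hz0⟩ := hS.1 (waveState lam g 0) 0 fun T => MemLp.zero
  obtain ⟨b₀, b₁, hp, hb⟩ := hz.exists_transportPath
  -- Before one full travel time the trace at 1 depends only on the initial state, so it agrees with
  -- that of the constant wave v, integrated to t v.
  set t := travel lam 1 / 2 with ht
  have hp1 := hl.travel_one_pos
  have htpos : 0 < t := half_pos hp1
  have h1 := ((hp.sub (hl.transportPath_wave hg)).zero_initial hl (by simp [hz0])).1 t htpos.le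
  rw [if_neg (by linarith), sub_eq_zero] at h1
  have h2 := PortSystem.boundary_iff S |>.1 (hb t htpos.le)
  have h3 : b₁ t = t • v := by rw [h1]; simp [g]
  rw [h3] at h2
  have e1 : ∀ {a : ℕ} (L : Matrix (Fin a) (Fin n) ℂ), mv L (t • v) = t • mv L v :=
    fun L => (mv L).map_smul_of_tower t v
  have e2 : ∀ {a : ℕ} (L : Matrix (Fin a) (Fin n) ℂ), mv L (t⁻¹ • b₀ t) = t⁻¹ • mv L (b₀ t) :=
    fun L => (mv L).map_smul_of_tower _ _
  have e3 : ∀ {a : ℕ} (x : Vec a), x = t⁻¹ • t • x := fun x => by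
    rw [smul_smul, inv_mul_cancel₀ htpos.ne', one_smul]
  refine ⟨t⁻¹ • b₀ t, ?_, ?_⟩
  · rw [e2, e3 (mv S.L₀ v), ← e1, ← smul_add, h2.1, smul_zero]
  · rw [e2, e3 (mv S.Lu v), ← e1, ← smul_add, h2.2.1]
    simp

/-- A well-posed system with as many boundary conditions and inputs as state components is a
discrete-time system `b₀ = A b₁ + B u` for the boundary values. -/
theorem PortSystem.WellPosed.exists_discrete {S : PortSystem n c p k} (hS : S.WellPosed lam)
    (hn : c + p = n) {s : ℂ} (hs : s ∈ S.resolventSet lam) :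
    ∃ (A : Vec n →L[ℂ] Vec n) (B : Vec p →L[ℂ] Vec n), ∀ b₀ b₁ u,
      (mv S.K₀ b₀ + mv S.L₀ b₁ = 0 ∧ mv S.Ku b₀ + mv S.Lu b₁ = u) ↔ b₀ = A b₁ + B u := by
  set T : Vec n →ₗ[ℂ] Vec c × Vec p := (mv S.K₀ : Vec n →ₗ[ℂ] Vec c).prod (mv S.Ku) with hT
  set N : Vec n →ₗ[ℂ] Vec c × Vec p := (mv S.L₀ : Vec n →ₗ[ℂ] Vec c).prod (mv S.Lu) with hN
  have hdim : Module.finrank ℂ (Vec n) = Module.finrank ℂ (Vec c × Vec p) := by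
    simp [hn]
  set ε := Complex.exp (-(s * travel lam 1)) with hε
  -- A kernel vector would be the trace at 0 of an exponential solution without input.
  have hinj : Function.Injective (T + ε • N : Vec n →ₗ[ℂ] Vec c × Vec p) := by
    rw [← LinearMap.ker_eq_bot, LinearMap.ker_eq_bot']
    intro b hb
    obtain ⟨x, hx⟩ := hl.transportOp_exp s b
    have h1 : mv S.K₀ b + ε • mv S.L₀ b = 0 := congrArg Prod.fst hb
    have h2 : mv S.Ku b + ε • mv S.Lu b = 0 := congrArg Prod.snd hb
    refine (S.traces_eq_zero hs hx (S.boundary_iff.2 ⟨?_, ?_, rfl⟩)).1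
    · rw [map_smul, h1]
    · rw [map_smul, h2]
  -- `exists_boundary` puts the range of N inside that of T, so T inherits the surjectivity of T +
  -- εN.
  have hsurj : Function.Surjective T := by
    intro q
    obtain ⟨b, hb⟩ := (LinearMap.injective_iff_surjective_of_finrank_eq_finrank hdim).1 hinj q
    obtain ⟨b', h1, h2⟩ := hS.exists_boundary hl (ε • b)
    have h3 : T b' + N (ε • b) = 0 := Prod.ext h1 h2
    refine ⟨b - b', ?_⟩
    rw [map_sub, ← hb, LinearMap.add_apply, LinearMap.smul_apply, ← map_smul,
      eq_neg_of_add_eq_zero_left h3]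
    abel
  have hTinj := (LinearMap.injective_iff_surjective_of_finrank_eq_finrank hdim).2 hsurj
  set e := LinearEquiv.ofBijective T ⟨hTinj, hsurj⟩ with he
  refine ⟨LinearMap.toContinuousLinearMap (-(e.symm.toLinearMap ∘ₗ N)),
    LinearMap.toContinuousLinearMap (e.symm.toLinearMap ∘ₗ LinearMap.inr ℂ (Vec c) (Vec p)),
    fun b₀ b₁ u => ?_⟩
  have h1 : (mv S.K₀ b₀ + mv S.L₀ b₁ = 0 ∧ mv S.Ku b₀ + mv S.Lu b₁ = u) ↔
      e b₀ + N b₁ = (0, u) := by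
    rw [Prod.ext_iff]
    rfl
  rw [h1, ← eq_sub_iff_add_eq, ← LinearEquiv.eq_symm_apply, map_sub]
  simp [sub_eq_neg_add]

end boundary

/-! ### Output nulling subspaces of discrete-time systems -/

section nulling

variable {X U Y : Type*} [AddCommGroup X] [Module ℂ X] [AddCommGroup U] [Module ℂ U]
  [AddCommGroup Y] [Module ℂ Y] (A : X →ₗ[ℂ] X) (B : U →ₗ[ℂ] X) (C : X →ₗ[ℂ] Y) (D : U →ₗ[ℂ] Y)

/-- The initial states of `x⁺ = A x + B u`, `y = C x + D u` for which some input yields `y = 0`. -/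
def nulling : Submodule ℂ X where
  carrier := {x | ∃ (ξ : ℕ → X) (u : ℕ → U), ξ 0 = x ∧
    ∀ j, ξ (j + 1) = A (ξ j) + B (u j) ∧ C (ξ j) + D (u j) = 0}
  add_mem' := by
    rintro _ _ ⟨ξ, u, rfl, h⟩ ⟨ξ', u', rfl, h'⟩
    refine ⟨fun j => ξ j + ξ' j, fun j => u j + u' j, rfl, fun j => ⟨?_, ?_⟩⟩
    · beta_reduce
      rw [(h j).1, (h' j).1, map_add, map_add]; abel
    · rw [map_add, map_add, add_add_add_comm, (h j).2, (h' j).2, add_zero]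
  zero_mem' := ⟨0, 0, rfl, by simp⟩
  smul_mem' := by
    rintro a _ ⟨ξ, u, rfl, h⟩
    refine ⟨fun j => a • ξ j, fun j => a • u j, rfl, fun j => ⟨?_, ?_⟩⟩
    · beta_reduce
      rw [(h j).1, map_smul, map_smul, smul_add]
    · rw [map_smul, map_smul, ← smul_add, (h j).2, smul_zero]

variable {A B C D}

/-- Dropping the first step of a nulling trajectory leaves a nulling trajectory. -/
theorem exists_mem_nulling {x : X} (hx : x ∈ nulling A B C D) :
    ∃ u, A x + B u ∈ nulling A B C D ∧ C x + D u = 0 := by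
  obtain ⟨ξ, u, rfl, h⟩ := hx
  exact ⟨u 0, ⟨fun j => ξ (j + 1), fun j => u (j + 1), (h 0).1, fun j => h (j + 1)⟩, (h 0).2⟩

/-- If the nulling input is unique, it is a linear feedback. -/
theorem exists_nulling_feedback
    (huniq : ∀ u, B u ∈ nulling A B C D → D u = 0 → u = 0) :
    ∃ F : nulling A B C D →ₗ[ℂ] U, ∀ x : nulling A B C D,
      (A x + B (F x) ∈ nulling A B C D ∧ C x + D (F x) = 0) ∧
      ∀ u, A x + B u ∈ nulling A B C D → C x + D u = 0 → u = F x := by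
  have hu : ∀ (x : X) (u u' : U), A x + B u ∈ nulling A B C D → C x + D u = 0 →
      A x + B u' ∈ nulling A B C D → C x + D u' = 0 → u = u' := fun x u u' h1 h2 h3 h4 => by
    refine sub_eq_zero.1 (huniq _ ?_ ?_)
    · simpa using Submodule.sub_mem _ h1 h3
    · rw [map_sub, sub_eq_zero]
      exact add_left_cancel (h2.trans h4.symm)
  choose f hf using fun x : nulling A B C D => exists_mem_nulling x.2
  refine ⟨{ toFun := f, map_add' := fun x x' => ?_, map_smul' := fun a x => ?_ },
    fun x => ⟨hf x, fun u h1 h2 => hu x u _ h1 h2 (hf x).1 (hf x).2⟩⟩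
  · refine hu _ _ _ (hf _).1 (hf _).2 ?_ ?_
    · convert Submodule.add_mem _ (hf x).1 (hf x').1 using 1
      push_cast
      simp only [map_add]
      abel
    · push_cast
      rw [map_add, map_add, add_add_add_comm, (hf x).2, (hf x').2, add_zero]
  · refine hu _ _ _ (hf _).1 (hf _).2 ?_ ?_
    · convert Submodule.smul_mem _ a (hf x).1 using 1
      simp
    · change C (a • (x : X)) + D (a • f x) = 0
      rw [map_smul, map_smul, ← smul_add, (hf x).2, smul_zero]

/-- If a nonzero scalar input keeps the zero state output nulling, the transfer function vanishes
wherever it is determined. -/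
theorem output_eq_zero_of_nulling [FiniteDimensional ℂ X] (hU : Module.finrank ℂ U = 1) {u : U}
    (hu : u ≠ 0) (hB : B u ∈ nulling A B C D) (hD : D u = 0) {μ : ℂ}
    (hμ : ∀ x, A x = μ • x → x = 0) (v : U) :
    ∃ x, A x + B v = μ • x ∧ C x + D v = 0 := by
  have hspan : ∀ v : U, ∃ a : ℂ, a • u = v := fun v => by
    exact exists_smul_eq_of_finrank_eq_one hU hu v
  set V := nulling A B C D
  have hBV : ∀ v, B v ∈ V := fun v => by
    obtain ⟨a, rfl⟩ := hspan v
    rw [map_smul]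
    exact V.smul_mem a hB
  have hD0 : ∀ v, D v = 0 := fun v => by
    obtain ⟨a, rfl⟩ := hspan v
    rw [map_smul, hD, smul_zero]
  have hC : ∀ x ∈ V, C x = 0 := fun x hx => by
    obtain ⟨w, _, h⟩ := exists_mem_nulling hx
    rwa [hD0, add_zero] at h
  have hA : ∀ x ∈ V, A x ∈ V := fun x hx => by
    obtain ⟨w, h, _⟩ := exists_mem_nulling hx
    simpa using V.sub_mem h (hBV w)
  -- V is A-invariant and finite dimensional, so the injective μ - A is onto on V; the solution x
  -- then lies in V, where C vanishes.
  let P : V →ₗ[ℂ] V := μ • LinearMap.id - A.restrict hA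
  have hP : Function.Injective P := by
    rw [← LinearMap.ker_eq_bot, LinearMap.ker_eq_bot']
    intro x hx
    have h1 : μ • (x : X) - A x = 0 := congrArg Subtype.val hx
    exact Subtype.ext (hμ x (sub_eq_zero.1 h1).symm)
  obtain ⟨x, hx⟩ := LinearMap.injective_iff_surjective.1 hP ⟨B v, hBV v⟩
  have h1 : μ • (x : X) - A x = B v := congrArg Subtype.val hx
  exact ⟨x, by rw [← h1]; abel, by rw [hC x x.2, hD0, add_zero]⟩

end nulling

/-- A basis of the nulling subspace V turns its inclusion into J, the closed loop A + BF on V into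
`Aw`, and d into dim V. -/
theorem exists_nulling_matrices {n p k : ℕ} {A : Vec n →ₗ[ℂ] Vec n} {B : Vec p →ₗ[ℂ] Vec n}
    {C : Vec n →ₗ[ℂ] Vec k} {D : Vec p →ₗ[ℂ] Vec k}
    (huniq : ∀ u, B u ∈ nulling A B C D → D u = 0 → u = 0) :
    ∃ d ≤ n, ∃ (Aw : Matrix (Fin d) (Fin d) ℂ) (J : Matrix (Fin n) (Fin d) ℂ)
      (F : Vec d →ₗ[ℂ] Vec p),
      Function.Injective (mv J) ∧ (∀ x, x ∈ nulling A B C D ↔ ∃ w, mv J w = x) ∧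
      ∀ w, (A (mv J w) + B (F w) = mv J (mv Aw w) ∧ C (mv J w) + D (F w) = 0) ∧
        ∀ u, A (mv J w) + B u ∈ nulling A B C D → C (mv J w) + D u = 0 → u = F w := by
  let V := nulling A B C D
  obtain ⟨F, hF⟩ : ∃ F : V →ₗ[ℂ] Vec p, ∀ x : V, (A x + B (F x) ∈ V ∧ C x + D (F x) = 0) ∧
    ∀ u, A x + B u ∈ V → C x + D u = 0 → u = F x := exists_nulling_feedback huniq
  let e : Vec (Module.finrank ℂ V) ≃ₗ[ℂ] V := LinearEquiv.ofFinrankEq _ _ (by simp)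
  let P : V →ₗ[ℂ] V := (A ∘ₗ V.subtype + B ∘ₗ F).codRestrict V fun x => (hF x).1.1
  obtain ⟨J, hJ⟩ := exists_mv_eq (V.subtype ∘ₗ e.toLinearMap)
  obtain ⟨Aw, hAw⟩ := exists_mv_eq (e.symm.toLinearMap ∘ₗ P ∘ₗ e.toLinearMap)
  have hJ' : ∀ w, mv J w = e w := hJ
  refine ⟨_, (Submodule.finrank_le V).trans (by simp), Aw, J, F ∘ₗ e.toLinearMap, ?_, ?_, ?_⟩
  · intro w w' h
    rw [hJ', hJ'] at h
    exact e.injective (Subtype.ext h)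
  · refine fun x => ⟨fun hx => ⟨e.symm ⟨x, hx⟩, by simp [hJ']⟩, ?_⟩
    rintro ⟨w, rfl⟩
    rw [hJ']
    exact (e w).2
  · intro w
    rw [hJ', hJ', hAw]
    refine ⟨⟨?_, (hF (e w)).1.2⟩, (hF (e w)).2⟩
    simp only [LinearMap.coe_comp, LinearEquiv.coe_coe, Function.comp_apply,
      LinearEquiv.apply_symm_apply]
    rfl

/-! ### Well-posedness of autonomous systems -/

theorem LocL2.intervalIntegrable {n : ℕ} {y : ℝ → Vec n} (hy : LocL2 y) {T : ℝ} (hT : 0 ≤ T) :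
    IntervalIntegrable y volume 0 T :=
  (intervalIntegrable_iff_integrableOn_Ioc_of_le hT).2 ((hy T).integrable (by norm_num))

theorem LocL2.ae_eq_of_integral_eq {n : ℕ} {y y' : ℝ → Vec n} (hy : LocL2 y) (hy' : LocL2 y')
    (h : ∀ t, 0 ≤ t → ∫ s in (0 : ℝ)..t, y s = ∫ s in (0 : ℝ)..t, y' s) :
    ∀ᵐ t ∂(volume.restrict (Ioi (0 : ℝ))), y t = y' t := by
  have key : ∀ N : ℕ, ∀ᵐ t, t ∈ Ioo (0 : ℝ) N → y t - y' t = 0 := fun N =>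
    ae_eq_zero_of_primitive_eq_zero N.cast_nonneg
      ((hy.intervalIntegrable N.cast_nonneg).sub (hy'.intervalIntegrable N.cast_nonneg))
      fun t ht => by
        rw [intervalIntegral.integral_sub (hy.intervalIntegrable ht.1)
          (hy'.intervalIntegrable ht.1), h t ht.1, sub_self]
  rw [ae_restrict_iff' measurableSet_Ioi]
  filter_upwards [ae_all_iff.2 key] with t ht h0
  obtain ⟨N, hN⟩ := exists_nat_gt t
  exact sub_eq_zero.1 (ht N ⟨h0, hN⟩)

theorem integral_norm_sq_eq {n : ℕ} {f : ℝ → Vec n} {T : ℝ} (hT : 0 ≤ T)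
    (hf : MemLp f 2 (volume.restrict (Ioc 0 T))) :
    ∫ s in (0 : ℝ)..T, ‖f s‖ ^ 2 = (eLpNorm f 2 (volume.restrict (Ioc 0 T))).toReal ^ 2 := by
  have h0 : 0 ≤ ∫ s in Ioc 0 T, ‖f s‖ ^ 2 := integral_nonneg fun _ => sq_nonneg _
  rw [hf.eLpNorm_eq_integral_rpow_norm (by norm_num) (by norm_num),
    intervalIntegral.integral_of_le hT]
  simp only [ENNReal.toReal_ofNat, Real.rpow_two]
  rw [ENNReal.toReal_ofReal (Real.rpow_nonneg h0 _), ← Real.rpow_two, ← Real.rpow_mul h0]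
  norm_num

theorem eLpNorm_delay_output_le {n k : ℕ} (L L' : Vec n →L[ℂ] Vec k) {f : ℝ → Vec n}
    (hf : MemLp f 2 volume) (d : ℝ) :
    eLpNorm (fun s => L (f s) + L' (f (s - d))) 2 volume ≤
      (‖L‖₊ + ‖L'‖₊) * eLpNorm f 2 volume := by
  have hle : ∀ (L : Vec n →L[ℂ] Vec k) (f : ℝ → Vec n),
      eLpNorm (fun s => L (f s)) 2 volume ≤ ‖L‖₊ * eLpNorm f 2 volume := fun L f =>
    eLpNorm_le_nnreal_smul_eLpNorm_of_ae_le_mul (Eventually.of_forall fun x => L.le_opNNNorm _) 2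
  have hs : MemLp (fun s => f (s - d)) 2 volume :=
    hf.comp_measurePreserving (measurePreserving_sub_right volume d)
  have hshift : eLpNorm (fun s => f (s - d)) 2 volume = eLpNorm f 2 volume :=
    eLpNorm_comp_measurePreserving hf.1 (measurePreserving_sub_right volume d)
  refine (eLpNorm_add_le (L.comp_memLp' hf).1 (L'.comp_memLp' hs).1 (by norm_num)).trans ?_
  rw [add_mul]
  nth_rewrite 2 [← hshift]
  exact add_le_add (hle L f) (hle L' _)

section autonomous

variable {k p : ℕ} {lam : ℝ → ℝ} {m M : ℝ} (hl : SpeedBound lam m M)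
  {R : PortSystem k k 0 p} {A : Matrix (Fin k) (Fin k) ℂ}

theorem PortSystem.boundary_autonomous (hK : R.K₀ = 1) (hL : R.L₀ = -A) {b₀ b₁ : Vec k}
    {v : Vec 0} {y : Vec p} :
    R.Boundary b₀ b₁ v y ↔ b₀ = mv A b₁ ∧ mv R.Ky b₀ + mv R.Ly b₁ = y := by
  rw [boundary_iff, hK, hL, mv_one, mv_neg, ← sub_eq_add_neg, sub_eq_zero,
    and_iff_right (Subsingleton.elim _ v)]

include hl

/-- The difference has zero initial state, so its integrated trace at 0 is A times its own delay, or
zero before the first delay; it vanishes window by window. -/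
theorem PortSystem.autonomous_unique (hK : R.K₀ = 1) (hL : R.L₀ = -A)
    {z z' : ℝ → State k} {u u' : ℝ → Vec 0} {y y' : ℝ → Vec p}
    (h : R.IsMildSolution lam z u y) (h' : R.IsMildSolution lam z' u' y') (h0 : z 0 = z' 0) :
    (∀ t, 0 ≤ t → z t = z' t) ∧ ∀ᵐ t ∂(volume.restrict (Ioi (0 : ℝ))), y t = y' t := by
  obtain ⟨b₀, b₁, hp, hb⟩ := h.exists_transportPath
  obtain ⟨b₀', b₁', hp', hb'⟩ := h'.exists_transportPath
  have hd := hp.sub hp'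
  have hbd := fun t ht => (boundary_autonomous hK hL).1 ((hb t ht).sub (hb' t ht))
  obtain ⟨h1, h2⟩ := hd.zero_initial hl (by rw [h0, sub_self])
  have hp1 := hl.travel_one_pos
  have hzero : ∀ N : ℕ, ∀ t, 0 ≤ t → t < N * travel lam 1 → b₀ t - b₀' t = 0 := by
    intro N
    induction N with
    | zero => intro t ht h; simp at h; linarith
    | succ N ih =>
      intro t ht h
      have h3 := (hbd t ht).1
      rw [h1 t ht] at h3
      rw [h3]
      split_ifs with hle
      · rw [ih _ (sub_nonneg.2 hle) (by push_cast at h; linarith), map_zero]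
      · rw [map_zero]
  have hzero' : ∀ t, 0 ≤ t → b₀ t - b₀' t = 0 := fun t ht => by
    obtain ⟨N, hN⟩ := exists_nat_gt (t / travel lam 1)
    exact hzero N t ht ((div_lt_iff₀ hp1).1 hN)
  refine ⟨fun t ht => sub_eq_zero.1 (h2 t (fun s hs => hzero' s hs.1) t ⟨ht, le_rfl⟩),
    h.2.2.1.ae_eq_of_integral_eq h'.2.2.1 fun t ht => ?_⟩
  have h3 := (hbd t ht).2
  have h4 : b₁ t - b₁' t = 0 := by
    rw [h1 t ht]
    split_ifs with hle
    · exact hzero' _ (sub_nonneg.2 hle)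
    · rfl
  rw [hzero' t ht, h4, map_zero, map_zero, add_zero] at h3
  exact (sub_eq_zero.1 h3.symm)

theorem PortSystem.wellPosed_autonomous (hK : R.K₀ = 1) (hL : R.L₀ = -A) : R.WellPosed lam := by
  have hp1 := hl.travel_one_pos
  let g : State k → ℝ → Vec k := fun z₀ => delaySol (mv A) (travel lam 1) (hl.profile z₀) 0
  let out : State k → ℝ → Vec p := fun z₀ t =>
    mv R.Ky (g z₀ t) + mv R.Ly (g z₀ (t - travel lam 1))
  have hg : ∀ z₀, LocSq (g z₀) := fun z₀ =>
    (LocSq.of_memLp (hl.memLp_profile z₀)).delaySol hp1 (LocSq.of_memLp MemLp.zero)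
  have hsol : ∀ z₀ (u : ℝ → Vec 0), LocL2 u →
      R.IsMildSolution lam (waveState lam (g z₀)) u (out z₀) := fun z₀ u hu =>
    hl.isMildSolution_wave R (hg z₀) hu
      (((hg z₀).map _).add (((hg z₀).shift _).map _)).locL2
      (Eventually.of_forall fun t ht => (boundary_autonomous hK hL).2
        ⟨(delaySol_of_pos hp1 ht).trans (add_zero _), rfl⟩)
  have hinit : ∀ z₀, waveState lam (g z₀) 0 = z₀ := fun z₀ =>
    hl.waveState_profile z₀ fun x hx => delaySol_of_nonpos hp1 hx
  refine ⟨fun z₀ u hu => ⟨_, _, hsol z₀ u hu, hinit z₀⟩,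
    fun z z' u y y' h h' h0 => autonomous_unique hl hK hL h h' h0, fun T hT => ?_⟩
  obtain ⟨C₁, hC₁⟩ := hl.exists_profile_bound k
  obtain ⟨C₂, hC₂⟩ := exists_delaySol_bound hp1 (mv A) T
  -- Cutting the profile at T changes neither state nor output on (0,T], and makes it globally
  -- square integrable with a norm controlled by z₀.
  let gT : State k → ℝ → Vec k := fun z₀ => (Iic T).indicator (g z₀)
  have hgT : ∀ z₀, MemLp (gT z₀) 2 volume ∧
      (eLpNorm (gT z₀) 2 volume).toReal ≤ C₂ * C₁ * ‖z₀‖ := fun z₀ => by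
    have h1 := hC₂ _ (hl.memLp_profile z₀)
    refine ⟨h1.1, ?_⟩
    have h2 : eLpNorm (gT z₀) 2 volume ≤ C₂ * (C₁ * eLpNorm z₀ 2 unitMeasure) :=
      h1.2.trans (mul_le_mul_right (hC₁ z₀).2 _)
    have h3 := ENNReal.toReal_mono (ENNReal.mul_ne_top ENNReal.coe_ne_top
      (ENNReal.mul_ne_top ENNReal.coe_ne_top (Lp.eLpNorm_ne_top z₀))) h2
    rw [ENNReal.toReal_mul, ENNReal.toReal_mul, ← mul_assoc, ← Lp.norm_def] at h3
    exact h3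
  set D₁ : ℝ := ‖hl.invMulL k‖ * (C₂ * C₁) with hD₁
  set D₂ : ℝ := (‖mv R.Ky‖ + ‖mv R.Ly‖) * (C₂ * C₁) with hD₂
  refine ⟨D₁ ^ 2 + D₂ ^ 2, fun z u y h t ht => ?_⟩
  obtain ⟨hz, hy⟩ := autonomous_unique hl hK hL h (hsol (z 0) u h.2.1) (hinit _).symm
  have b1 : ‖z t‖ ≤ D₁ * ‖z 0‖ := by
    have e : waveState lam (g (z 0)) t = waveState lam (gT (z 0)) t :=
      hl.waveState_congr (Eventually.of_forall fun x hx =>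
        (indicator_of_mem (show x ∈ Iic T from hx.2.le.trans ht.2) _).symm)
    rw [hz t ht.1, e, hD₁, mul_assoc]
    exact (hl.norm_waveState_le (hgT _).1 t).trans
      (mul_le_mul_of_nonneg_left (hgT _).2 (norm_nonneg _))
  have b2 : ∫ s in (0 : ℝ)..T, ‖y s‖ ^ 2 ≤ (D₂ * ‖z 0‖) ^ 2 := by
    rw [integral_norm_sq_eq hT.le (h.2.2.1 T)]
    refine pow_le_pow_left₀ ENNReal.toReal_nonneg ?_ 2
    have hgm := (hgT (z 0)).1
    have e : y =ᵐ[volume.restrict (Ioc 0 T)] fun s =>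
        mv R.Ky (gT (z 0) s) + mv R.Ly (gT (z 0) (s - travel lam 1)) := by
      have hy' := ae_restrict_of_ae_restrict_of_subset (t := Ioi (0 : ℝ)) (s := Ioc 0 T)
        (fun x hx => hx.1) hy
      filter_upwards [hy', ae_restrict_mem measurableSet_Ioc] with s h1 h2
      rw [h1]
      simp only [gT, out]
      rw [indicator_of_mem (show s ∈ Iic T from h2.2),
        indicator_of_mem (show s - travel lam 1 ∈ Iic T from by
          have := h2.2
          simp only [mem_Iic]; linarith)]
    have h1 : eLpNorm y 2 (volume.restrict (Ioc 0 T)) ≤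
        (‖mv R.Ky‖₊ + ‖mv R.Ly‖₊) * eLpNorm (gT (z 0)) 2 volume := by
      rw [eLpNorm_congr_ae e]
      exact (eLpNorm_mono_measure _ Measure.restrict_le_self).trans
        (eLpNorm_delay_output_le _ _ hgm _)
    have h2 := ENNReal.toReal_mono (ENNReal.mul_ne_top (by simp) hgm.eLpNorm_ne_top) h1
    rw [ENNReal.toReal_mul, ENNReal.toReal_add (by simp) (by simp)] at h2
    rw [hD₂, mul_assoc]
    exact h2.trans (mul_le_mul_of_nonneg_left (hgT _).2 (by positivity))
  have hu : 0 ≤ ∫ s in (0 : ℝ)..T, ‖u s‖ ^ 2 :=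
    intervalIntegral.integral_nonneg hT.le fun _ _ => sq_nonneg _
  have b1' : ‖z t‖ ^ 2 ≤ (D₁ * ‖z 0‖) ^ 2 := pow_le_pow_left₀ (norm_nonneg _) b1 2
  have hpos : 0 ≤ (D₁ ^ 2 + D₂ ^ 2) * ∫ s in (0 : ℝ)..T, ‖u s‖ ^ 2 :=
    mul_nonneg (by positivity) hu
  nlinarith

end autonomous

/-! ### Images of states under matrices -/

/-- The pointwise action of a matrix on states. -/
def mapState {n k : ℕ} (J : Matrix (Fin n) (Fin k) ℂ) : State k →L[ℂ] State n :=
  (mv J).compLpL 2 unitMeasure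

section mapState

variable {n k : ℕ} {J : Matrix (Fin n) (Fin k) ℂ}

theorem mapState_ae (w : State k) : ∀ᵐ ζ ∂unitMeasure, mapState J w ζ = mv J (w ζ) :=
  (mv J).coeFn_compLp w

theorem isImage_iff {w : State k} {z : State n} : IsImage J w z ↔ z = mapState J w := by
  constructor
  · intro h
    refine Lp.ext ?_
    filter_upwards [h, mapState_ae (J := J) w] with ζ h1 h2
    rw [h2]
    exact WithLp.ofLp_injective 2 h1
  · rintro rfl
    filter_upwards [mapState_ae (J := J) w] with ζ h2
    rw [h2, mv_ofLp]

theorem prim_mapState (w : State k) (ζ : ℝ) : prim (mapState J w) ζ = mv J (prim w ζ) := by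
  rw [prim, prim, ← (mv J).integral_comp_comm w.integrable.integrableOn]
  exact integral_congr_ae (ae_restrict_of_ae (mapState_ae w))

theorem TransportOp.map {lam : ℝ → ℝ} {f g : State k} {b₀ b₁ : Vec k}
    (h : TransportOp lam f g b₀ b₁) (J : Matrix (Fin n) (Fin k) ℂ) :
    TransportOp lam (mapState J f) (mapState J g) (mv J b₀) (mv J b₁) := by
  rw [transportOp_iff] at *
  refine ⟨?_, by rw [h.2, map_sub, prim_mapState]⟩
  filter_upwards [h.1, mapState_ae (J := J) f] with ζ h1 h2
  rw [h2, ← map_smul, ← h1, map_sub, prim_mapState]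

end mapState

/-! ### Zero dynamics -/

namespace PortSystem

variable {n c p k d : ℕ} {lam : ℝ → ℝ} {m M : ℝ}

theorem reduced_boundary {S : PortSystem n c p k} {Aw : Matrix (Fin d) (Fin d) ℂ}
    {J : Matrix (Fin n) (Fin d) ℂ} {b₀ b₁ : Vec d} {v : Vec 0} {u : Vec p} :
    (S.reduced 1 (-Aw) J).Boundary b₀ b₁ v u ↔
      b₀ = mv Aw b₁ ∧ mv S.Ku (mv J b₀) + mv S.Lu (mv J b₁) = u := by
  rw [boundary_autonomous (A := Aw) rfl rfl, ← mv_mul, ← mv_mul]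
  rfl

/-- `A`, `B` describe the boundary conditions and inputs of `S` as `b₀ = A b₁ + B u`. -/
def IsDiscrete (S : PortSystem n c p k) (A : Vec n →L[ℂ] Vec n) (B : Vec p →L[ℂ] Vec n) : Prop :=
  ∀ b₀ b₁ u, (mv S.K₀ b₀ + mv S.L₀ b₁ = 0 ∧ mv S.Ku b₀ + mv S.Lu b₁ = u) ↔ b₀ = A b₁ + B u

/-- The output nulling subspace of the discrete-time system of boundary values. -/
def discreteNulling (S : PortSystem n c p k) (A : Vec n →L[ℂ] Vec n) (B : Vec p →L[ℂ] Vec n) :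
    Submodule ℂ (Vec n) :=
  nulling (A : Vec n →ₗ[ℂ] Vec n) (B : Vec p →ₗ[ℂ] Vec n)
    -- The discrete state is the trace b₁ at 1; these are C and D after substituting b₀ = A b₁ + B u
    -- into the output equation.
    ((mv S.Ky ∘L A + mv S.Ly : Vec n →L[ℂ] Vec k) : Vec n →ₗ[ℂ] Vec k)
    ((mv S.Ky ∘L B : Vec p →L[ℂ] Vec k) : Vec p →ₗ[ℂ] Vec k)

theorem IsDiscrete.boundary_iff {S : PortSystem n c p k} {A : Vec n →L[ℂ] Vec n}
    {B : Vec p →L[ℂ] Vec n} (h : S.IsDiscrete A B) {b₀ b₁ : Vec n} {u : Vec p} {y : Vec k} :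
    S.Boundary b₀ b₁ u y ↔ b₀ = A b₁ + B u ∧
      (mv S.Ky ∘L A + mv S.Ly) b₁ + (mv S.Ky ∘L B) u = y := by
  rw [PortSystem.boundary_iff, ← and_assoc, h]
  refine and_congr_right fun hb => ?_
  rw [hb]
  simp only [map_add, _root_.add_apply, ContinuousLinearMap.comp_apply]
  rw [add_right_comm]

/-- If the transfer function of a single-input system is not identically zero, the nulling input
is unique. -/
theorem IsDiscrete.nulling_input_unique (hl : SpeedBound lam m M) {S : PortSystem n c 1 k}
    {A : Vec n →L[ℂ] Vec n} {B : Vec 1 →L[ℂ] Vec n} (hAB : S.IsDiscrete A B)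
    {G : ℂ → Matrix (Fin k) (Fin 1) ℂ} (hG : S.IsTransferFunction lam G)
    (hG0 : ∃ s ∈ S.resolventSet lam, G s ≠ 0) (u : Vec 1) (hB : B u ∈ S.discreteNulling A B)
    (hD : (mv S.Ky ∘L B) u = 0) : u = 0 := by
  obtain ⟨s, hs, hGs⟩ := hG0
  by_contra hu
  refine hGs ?_
  -- An exponential solution with trace x at 1 has trace μx at 0, so its boundary equation is A x +
  -- B v = μ x.
  set μ := Complex.exp (s * travel lam 1) with hμ
  have hμ' : ∀ x : Vec n, Complex.exp (-(s * travel lam 1)) • μ • x = x := fun x => by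
    rw [smul_smul, hμ, ← Complex.exp_add, neg_add_cancel, Complex.exp_zero, one_smul]
  have hinj : ∀ x, A x = μ • x → x = 0 := fun x hx => by
    obtain ⟨f, hf⟩ := hl.transportOp_exp s (μ • x)
    rw [hμ'] at hf
    exact (S.traces_eq_zero hs hf (hAB.boundary_iff.2 ⟨by rw [← hx, map_zero, add_zero], rfl⟩)).2
  have hzero : ∀ v : Vec 1, G s *ᵥ v.ofLp = 0 := fun v => by
    obtain ⟨x, hx, hy⟩ := output_eq_zero_of_nulling (by simp) hu hB hD hinj v
    obtain ⟨f, hf⟩ := hl.transportOp_exp s (μ • x)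
    rw [hμ'] at hf
    have hb : S.Boundary (μ • x) x v 0 := hAB.boundary_iff.2 ⟨hx.symm, hy⟩
    obtain ⟨f', b₀, b₁, hf', hb'⟩ := hG s hs v
    -- Both exponential solutions have input v; their difference has none, hence zero traces, and
    -- the outputs agree.
    have hd := hf'.sub hf
    rw [← smul_sub] at hd
    have hbd := hb'.sub hb
    rw [sub_self, sub_zero] at hbd
    obtain ⟨e0, e1⟩ := S.traces_eq_zero hs hd hbd
    rw [e0, e1] at hbd
    have h0 := hbd.2.2
    simpa using h0.symm
  ext i j
  have h1 := congrFun (hzero (WithLp.toLp 2 (Pi.single j 1))) i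
  simpa using h1

/-- The mild solutions of the reduced system give mild solutions with zero output. -/
theorem isMildSolution_of_reduced {S : PortSystem n c p k} {Aw : Matrix (Fin d) (Fin d) ℂ}
    {J : Matrix (Fin n) (Fin d) ℂ} {A : Vec n →L[ℂ] Vec n} {B : Vec p →L[ℂ] Vec n}
    (hAB : S.IsDiscrete A B) {F : Vec d →ₗ[ℂ] Vec p}
    (hF : ∀ w, A (mv J w) + B (F w) = mv J (mv Aw w) ∧
      (mv S.Ky ∘L A + mv S.Ly) (mv J w) + (mv S.Ky ∘L B) (F w) = 0)
    {w : ℝ → State d} {u : ℝ → Vec p} (hw : (S.reduced 1 (-Aw) J).IsMildSolution lam w 0 u)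
    {z : ℝ → State n} (hz : ∀ t, 0 ≤ t → z t = mapState J (w t)) :
    S.IsMildSolution lam z u 0 := by
  refine ⟨((mapState J).continuous.comp_continuousOn hw.1).congr fun t ht => hz t ht, hw.2.2.1,
    fun T => MemLp.zero, fun t ht => ?_⟩
  obtain ⟨b₀, b₁, hT, hb⟩ := hw.2.2.2 t ht
  obtain ⟨rfl, hu⟩ := reduced_boundary.1 hb
  refine ⟨mv J (mv Aw b₁), mv J b₁, ?_, ?_⟩
  · have h1 : ∫ s in (0 : ℝ)..t, z s = mapState J (∫ s in (0 : ℝ)..t, w s) := by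
      rw [← (mapState J).intervalIntegral_comp_comm
        (intervalIntegrable_of_continuousOn_Ici hw.1 ht)]
      refine intervalIntegral.integral_congr fun s hs => ?_
      rw [uIcc_of_le ht] at hs
      exact hz s hs.1
    rw [h1, hz t ht, hz 0 le_rfl, ← map_sub]
    exact hT.map J
  -- The feedback identities are linear, so they apply directly to the integrated traces and give
  -- the integrated input as F b₁.
  · obtain ⟨h1, h2⟩ := hF b₁
    have h3 : mv S.Ku (mv J (mv Aw b₁)) + mv S.Lu (mv J b₁) = F b₁ :=
      ((hAB _ _ _).2 h1.symm).2
    refine hAB.boundary_iff.2 ⟨?_, ?_⟩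
    · rw [← hu, h3, h1]
    · rw [← hu, h3, h2]
      simp

/-- A mild solution of a well-posed system is the wave generated by the delay recursion. -/
theorem WellPosed.eq_wave (hl : SpeedBound lam m M) {S : PortSystem n c p k}
    (hS : S.WellPosed lam) {A : Vec n →L[ℂ] Vec n} {B : Vec p →L[ℂ] Vec n}
    (hAB : S.IsDiscrete A B) {z : ℝ → State n} {u : ℝ → Vec p} {y : ℝ → Vec k}
    (h : S.IsMildSolution lam z u y) :
    ∃ g : ℝ → Vec n, LocSq g ∧ (∀ t, 0 ≤ t → z t = waveState lam g t) ∧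
      (∀ t, 0 < t → g t = A (g (t - travel lam 1)) + B (u t)) ∧
      ∀ᵐ t, 0 < t →
        (mv S.Ky ∘L A + mv S.Ly) (g (t - travel lam 1)) + (mv S.Ky ∘L B) (u t) = y t := by
  have hp1 := hl.travel_one_pos
  have hu := h.2.1.locSq_indicator
  set g := delaySol A (travel lam 1) (hl.profile (z 0))
    (fun t => B ((Ioi (0 : ℝ)).indicator u t)) with hg
  have hgl : LocSq g := (LocSq.of_memLp (hl.memLp_profile (z 0))).delaySol hp1 (hu.map B)
  have hrec : ∀ t, 0 < t → g t = A (g (t - travel lam 1)) + B (u t) := fun t ht => by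
    rw [hg, delaySol_of_pos hp1 ht, indicator_of_mem (mem_Ioi.2 ht)]
  set out : ℝ → Vec k := fun t => mv S.Ky (g t) + mv S.Ly (g (t - travel lam 1)) with hout
  have hsol : S.IsMildSolution lam (waveState lam g) u out :=
    hl.isMildSolution_wave S hgl h.2.1 ((hgl.map _).add ((hgl.shift _).map _)).locL2
      (Eventually.of_forall fun t ht => S.boundary_iff.2
        ⟨((hAB _ _ _).2 (hrec t ht)).1, ((hAB _ _ _).2 (hrec t ht)).2, rfl⟩)
  have h0 : z 0 = waveState lam g 0 :=
    (hl.waveState_profile (z 0) fun x hx => delaySol_of_nonpos hp1 hx).symm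
  obtain ⟨hz, hy⟩ := hS.2.1 _ _ _ _ _ h hsol h0
  refine ⟨g, hgl, hz, hrec, ?_⟩
  rw [ae_restrict_iff' measurableSet_Ioi] at hy
  filter_upwards [hy] with t h1 h2
  rw [h1 h2]
  exact (hAB.boundary_iff.1 (S.boundary_iff.2
    ⟨((hAB _ _ _).2 (hrec t h2)).1, ((hAB _ _ _).2 (hrec t h2)).2, rfl⟩)).2

/-- The mild solutions with zero output come from the reduced system. -/
theorem exists_reduced_solution (hl : SpeedBound lam m M) {S : PortSystem n c p k}
    (hS : S.WellPosed lam) {A : Vec n →L[ℂ] Vec n} {B : Vec p →L[ℂ] Vec n}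
    (hAB : S.IsDiscrete A B) {Aw : Matrix (Fin d) (Fin d) ℂ} {J : Matrix (Fin n) (Fin d) ℂ}
    (hJ : Function.Injective (mv J))
    (hV : ∀ x, x ∈ S.discreteNulling A B ↔ ∃ w, mv J w = x) {F : Vec d →ₗ[ℂ] Vec p}
    (hF : ∀ w, A (mv J w) + B (F w) = mv J (mv Aw w))
    (hFu : ∀ w u, A (mv J w) + B u ∈ S.discreteNulling A B →
      (mv S.Ky ∘L A + mv S.Ly) (mv J w) + (mv S.Ky ∘L B) u = 0 → u = F w)
    {z : ℝ → State n} {u : ℝ → Vec p} (h : S.IsMildSolution lam z u 0) :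
    ∃ w : ℝ → State d, (S.reduced 1 (-Aw) J).IsMildSolution lam w 0 u ∧
      ∀ t, 0 ≤ t → IsImage J (w t) (z t) := by
  obtain ⟨g, hgl, hz, hrec, hout⟩ := hS.eq_wave hl hAB h
  set π := travel lam 1 with hπ
  have hp1 : 0 < π := hl.travel_one_pos
  have hshift : ∀ {P : ℝ → Prop}, (∀ᵐ x, P x) → ∀ a : ℝ, ∀ᵐ x, P (x + a) := fun h a =>
    (measurePreserving_add_right volume a).quasiMeasurePreserving.ae h
  have hmem : ∀ᵐ x, -π < x → g x ∈ S.discreteNulling A B := by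
    -- Countably many null sets are discarded, so that for almost every x the output equation holds
    -- along the whole lattice x + (j + 1)π.
    filter_upwards [ae_all_iff.2 fun j : ℕ => hshift hout ((j + 1) * π)] with x hx hxπ
    have hpos : ∀ j : ℕ, 0 < x + (j + 1) * π := fun j => by
      have : (0 : ℝ) ≤ j * π := by positivity
      linarith
    have hsub : ∀ j : ℕ, x + (j + 1) * π - π = x + j * π := fun j => by ring
    -- The input index is ahead by one: the discrete state is the trace at 1, which is the profile
    -- one travel time earlier.
    refine ⟨fun j => g (x + j * π), fun j => u (x + (j + 1) * π), by simp, fun j => ⟨?_, ?_⟩⟩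
    · have h1 := hrec _ (hpos j)
      rw [hsub] at h1
      beta_reduce
      push_cast
      exact h1
    · have h1 := hx j (hpos j)
      rw [hsub] at h1
      exact h1
  obtain ⟨Q, hQ⟩ := (mv J : Vec d →ₗ[ℂ] Vec n).exists_leftInverse_of_injective
    (LinearMap.ker_eq_bot.2 hJ)
  have hQ' : ∀ w, Q (mv J w) = w := fun w => LinearMap.congr_fun hQ w
  set gw : ℝ → Vec d := fun x => LinearMap.toContinuousLinearMap Q (g x) with hgw
  have hgwl : LocSq gw := hgl.map _
  have himage : ∀ᵐ x, -π < x → mv J (gw x) = g x := by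
    filter_upwards [hmem] with x hx hxπ
    obtain ⟨w, hw⟩ := (hV _).1 (hx hxπ)
    have : gw x = Q (g x) := rfl
    rw [this, ← hw, hQ']
  refine ⟨waveState lam gw, hl.isMildSolution_wave _ hgwl (fun T => MemLp.zero) h.2.1 ?_,
    fun t ht => ?_⟩
  · have hm' := hshift himage (-π)
    filter_upwards [hmem, himage, hm', hout] with t h1 h2 h3 h4 ht
    rw [← sub_eq_add_neg] at h3
    have h2' := h2 (by linarith)
    have h3' := h3 (by linarith)
    have h5 := hrec t ht
    have h6 := h4 ht
    -- The next profile value stays in the nulling subspace and the output is zero, so uniqueness of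
    -- the nulling input forces the feedback.
    have hu : u t = F (gw (t - π)) := by
      refine hFu _ _ ?_ ?_
      · rw [h3', ← h5]
        exact h1 (by linarith)
      · rw [h3']
        exact h6
    refine reduced_boundary.2 ⟨hJ ?_, ?_⟩
    · rw [h2', ← hF, h3', ← hu, h5]
    · rw [h2', h3']
      exact ((hAB _ _ _).2 h5).2
  · rw [hz t ht]
    have h1 := hl.ae_delay himage t
    filter_upwards [hl.waveState_ae hgl t, hl.waveState_ae hgwl t, ae_restrict_of_ae h1,
      ae_restrict_mem measurableSet_Ioo] with ζ e1 e2 e3 e4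
    have h2 := hl.travel_mem_Ioo e4
    rw [e1, e2, ← mv_ofLp, waveFun, waveFun, ← e3 (by linarith [h2.2])]
    exact congrArg WithLp.ofLp ((mv J).map_smul_of_tower _ _).symm

/-- The zero dynamics, for wave speeds that are bounded everywhere. -/
theorem exists_zeroDynamics (hl : SpeedBound lam m M) {S : PortSystem n c 1 k} (hn : c + 1 = n)
    (hS : S.WellPosed lam) {G : ℂ → Matrix (Fin k) (Fin 1) ℂ} (hG : S.IsTransferFunction lam G)
    (hG0 : ∃ s ∈ S.resolventSet lam, G s ≠ 0) :
    ∃ d : ℕ, d ≤ n ∧ ∃ (Kw Lw : Matrix (Fin d) (Fin d) ℂ) (J : Matrix (Fin n) (Fin d) ℂ),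
      IsUnit Kw ∧ Function.Injective J.mulVec ∧ (S.reduced Kw Lw J).WellPosed lam ∧
      S.outputNulling lam = {z₀ | ∃ w₀ : State d, IsImage J w₀ z₀} ∧
      ∀ (z : ℝ → State n) (u : ℝ → Vec 1), S.IsMildSolution lam z u 0 ↔
        ∃ w : ℝ → State d, (S.reduced Kw Lw J).IsMildSolution lam w 0 u ∧
          ∀ t : ℝ, 0 ≤ t → IsImage J (w t) (z t) := by
  obtain ⟨A, B, hAB⟩ : ∃ A B, S.IsDiscrete A B := by
    obtain ⟨s, hs, _⟩ := hG0
    exact hS.exists_discrete hl hn hs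
  obtain ⟨d, hd, Aw, J, F, hJ, hV, hF⟩ :=
    exists_nulling_matrices (hAB.nulling_input_unique hl hG hG0)
  have hwp : (S.reduced 1 (-Aw) J).WellPosed lam := wellPosed_autonomous hl (A := Aw) rfl rfl
  have hfwd : ∀ (z : ℝ → State n) (u : ℝ → Vec 1), S.IsMildSolution lam z u 0 →
      ∃ w : ℝ → State d, (S.reduced 1 (-Aw) J).IsMildSolution lam w 0 u ∧
        ∀ t : ℝ, 0 ≤ t → IsImage J (w t) (z t) := fun z u h =>
    exists_reduced_solution hl hS hAB hJ hV (fun w => (hF w).1.1) (fun w => (hF w).2) h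
  refine ⟨d, hd, 1, -Aw, J, isUnit_one, fun x y hxy => ?_, hwp, ?_, fun z u =>
    ⟨hfwd z u, ?_⟩⟩
  · have h1 : mv J (WithLp.toLp 2 x) = mv J (WithLp.toLp 2 y) := WithLp.ofLp_injective 2 hxy
    exact congrArg WithLp.ofLp (hJ h1)
  · ext z₀
    constructor
    · rintro ⟨z, u, h, rfl⟩
      obtain ⟨w, _, hw⟩ := hfwd z u h
      exact ⟨w 0, hw 0 le_rfl⟩
    · rintro ⟨w₀, h⟩
      obtain ⟨w, u, hw, rfl⟩ := hwp.1 w₀ 0 fun T => MemLp.zero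
      exact ⟨fun t => mapState J (w t), u,
        isMildSolution_of_reduced hAB (fun w => (hF w).1) hw fun t _ => rfl,
        (isImage_iff.1 h).symm⟩
  · rintro ⟨w, hw, hz⟩
    exact isMildSolution_of_reduced hAB (fun w => (hF w).1) hw fun t ht =>
      isImage_iff.1 (hz t ht)

/-- The wave speed enters only through `TransportOp`, which depends on its almost everywhere class;
the same holds for the notions below. -/
theorem isMildSolution_congr {lam' : ℝ → ℝ} (h : lam =ᵐ[unitMeasure] lam')
    (S : PortSystem n c p k) : S.IsMildSolution lam = S.IsMildSolution lam' := by
  funext z u y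
  simp only [IsMildSolution, transportOp_congr h]

theorem wellPosed_congr {lam' : ℝ → ℝ} (h : lam =ᵐ[unitMeasure] lam')
    (S : PortSystem n c p k) : S.WellPosed lam = S.WellPosed lam' := by
  simp only [WellPosed, isMildSolution_congr h]

theorem outputNulling_congr {lam' : ℝ → ℝ} (h : lam =ᵐ[unitMeasure] lam')
    (S : PortSystem n c p k) : S.outputNulling lam = S.outputNulling lam' := by
  simp only [outputNulling, isMildSolution_congr h]

theorem resolventSet_congr {lam' : ℝ → ℝ} (h : lam =ᵐ[unitMeasure] lam')
    (S : PortSystem n c p k) : S.resolventSet lam = S.resolventSet lam' := by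
  simp only [resolventSet, GeneratorGraph, transportOp_congr h]

theorem isTransferFunction_congr {lam' : ℝ → ℝ} (h : lam =ᵐ[unitMeasure] lam')
    (S : PortSystem n c p k) : S.IsTransferFunction lam = S.IsTransferFunction lam' := by
  funext G
  simp only [IsTransferFunction, IsExponentialSolution, transportOp_congr h, resolventSet_congr h]

end PortSystem

end PortHam

end

theorem theorem4p2 (n : ℕ) (hn : 1 ≤ n) (lam : ℝ → ℝ) (hlam : PortHam.IsWaveSpeed lam)
    (S : PortHam.PortSystem n (n - 1) 1 1) (hS : S.WellPosed lam)
    (G : ℂ → Matrix (Fin 1) (Fin 1) ℂ) (hG : S.IsTransferFunction lam G)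
    (hG0 : ∃ s ∈ S.resolventSet lam, G s ≠ 0) :
    ∃ k : ℕ, k ≤ n ∧
      ∃ (Kw Lw : Matrix (Fin k) (Fin k) ℂ) (J : Matrix (Fin n) (Fin k) ℂ),
        IsUnit Kw ∧ Function.Injective J.mulVec ∧
        (S.reduced Kw Lw J).WellPosed lam ∧
        S.outputNulling lam =
          {z₀ | ∃ w₀ : PortHam.State k, PortHam.IsImage J w₀ z₀} ∧
        ∀ (z : ℝ → PortHam.State n) (u : ℝ → PortHam.Vec 1),
          S.IsMildSolution lam z u 0 ↔
            ∃ w : ℝ → PortHam.State k,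
              (S.reduced Kw Lw J).IsMildSolution lam w 0 u ∧
                ∀ t : ℝ, 0 ≤ t → PortHam.IsImage J (w t) (z t) := by
  obtain ⟨lam', m, M, hl, h⟩ := hlam.exists_speedBound
  rw [PortHam.PortSystem.wellPosed_congr h] at hS
  rw [PortHam.PortSystem.isTransferFunction_congr h] at hG
  rw [PortHam.PortSystem.resolventSet_congr h] at hG0
  simp only [PortHam.PortSystem.wellPosed_congr h, PortHam.PortSystem.outputNulling_congr h,
    PortHam.PortSystem.isMildSolution_congr h]
  -- Since n ≥ 1, the truncated n - 1 conditions and the single input add up to n, which makes the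
  -- boundary matrix square.
  exact PortHam.PortSystem.exists_zeroDynamics hl (Nat.sub_add_cancel hn) hS hG hG0
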